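/- All Hilbert spaces are finite-dimensional and complex. A superoperator from $\mathcal H$ to $\mathcal K$ is a linear map $\mathcal B(\mathcal H)\to\mathcal B(\mathcal K)$; $\mathrm{CP}(\mathcal H,\mathcal K)$ is the set of the completely positive ones, and $\mathcal N\le_{\mathrm{CP}}\mathcal M$ means $\mathcal M-\mathcal N\in\mathrm{CP}(\mathcal H,\mathcal K)$. Let $f:(0,+\infty)\to\mathbb R$ be operator convex, and put $\tilde f(x):=xf(1/x)$, $f(0^+):=\lim_{x\searrow0}f(x)$, $\tilde f(0^+):=\lim_{x\searrow0}\tilde f(x)$. For positive semidefinite $A,B\in\mathcal B(\mathcal H)$ let $A^0$ be the projection onto $(\ker A)^\perp$, and let $$P_f(A,B):=\lim_{\varepsilon\searrow0}B_\varepsilon^{1/2}f\big(B_\varepsilon^{-1/2}A_\varepsilon B_\varepsilon^{-1/2}\big)B_\varepsilon^{1/2},\qquad A_\varepsilon:=A+\varepsilon I,\ B_\varepsilon:=B+\varepsilon I;$$ $P_f(A,B)$ is said to be defined if the limit exists. A Choi vector on $\mathcal H$ is a vector $\Psi=\sum_i\tilde e_i\otimes e_i\in\tilde{\mathcal H}\otimes\mathcal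 H$, where $(e_i)$ and $(\tilde e_i)$ are orthonormal bases of $\mathcal H$ and of a Hilbert space $\tilde{\mathcal H}$ with $\dim\tilde{\mathcal H}=\dim\mathcal H$; it gives the isomorphism $C_\Psi(\mathcal N):=(\mathrm{id}_{\mathcal B(\tilde{\mathcal H})}\otimes\mathcal N)(|\Psi\rangle\langle\Psi|)$ from superoperators $\mathcal B(\mathcal H)\to\mathcal B(\mathcal K)$ onto $\mathcal B(\tilde{\mathcal H}\otimes\mathcal K)$. For $\mathcal N,\mathcal M\in\mathrm{CP}(\mathcal H,\mathcal K)$, the superoperator perspective is $$P_f(\mathcal N,\mathcal M):=C_\Psi^{-1}\big(P_f(C_\Psi(\mathcal N),C_\Psi(\mathcal M))\big),$$ and is said to be defined if $P_f(C_\Psi(\mathcal N),C_\Psi(\mathcal M))$ is. Let $\mathcal N,\mathcal M\in\mathrm{CP}(\mathcal H,\mathcal K)$ be such that for some Choi vector $\Psi$ on $\mathcal H$, $A:=C_\Psi(\mathcal N)$ and $B:=C_\Psi(\mathcal M)$ satisfy at least one of - (S1) $A^0=B^0$; - (S2) $f(0^+)<+\infty$ and $\tilde f(0^+)<+\infty$;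 - (S3) $f(0^+)<+\infty$ and $A^0\le B^0$; - (S4) $\tilde f(0^+)<+\infty$ and $A^0\ge B^0$. Then at least one of (S1)–(S4) holds for every Choi vector on $\mathcal H$, $P_f(\mathcal N,\mathcal M)$ is defined and does not depend on the Choi vector, and the following hold (each perspective on a left-hand side being defined, and the statement being true, for every choice of the Choi vector): 1. (Post-processing) For every $\mathcal F\in\mathrm{CP}(\mathcal K,\mathcal L)$, $P_f(\mathcal F\circ\mathcal N,\mathcal F\circ\mathcal M)$ is defined and $$P_f(\mathcal F\circ\mathcal N,\mathcal F\circ\mathcal M)\le_{\mathrm{CP}}\mathcal F\circ P_f(\mathcal N,\mathcal M),$$ with equality if $\mathcal F$ has a completely positive inverse. 2. (Pre-processing) For every $\mathcal E\in\mathrm{CP}(\mathcal L,\mathcal H)$, $P_f(\mathcal N\circ\mathcal E,\mathcal M\circ\mathcal E)$ is defined and $$P_f(\mathcal N\circ\mathcal E,\mathcal M\circ\mathcal E)\le_{\mathrm{CP}}P_f(\mathcal N,\mathcal M)\circ\mathcal E.$$ 3. (Supermaps) Let $\Theta$ be a completely positive supermap, that is, a linear map from superoperators $\mathcal B(\mathcal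 H)\to\mathcal B(\mathcal K)$ to superoperators $\mathcal B(\mathcal H_2)\to\mathcal B(\mathcal K_2)$ such that, for all finite-dimensional $\mathcal R,\mathcal S$, $\mathrm{id}\otimes\Theta$ maps $\mathrm{CP}(\mathcal R\otimes\mathcal H,\mathcal S\otimes\mathcal K)$ into $\mathrm{CP}(\mathcal R\otimes\mathcal H_2,\mathcal S\otimes\mathcal K_2)$. Then $P_f(\Theta(\mathcal N),\Theta(\mathcal M))$ is defined and $$P_f(\Theta(\mathcal N),\Theta(\mathcal M))\le_{\mathrm{CP}}\Theta\big(P_f(\mathcal N,\mathcal M)\big).$$ The same holds, more generally, for every linear $\Theta$ that maps $\mathrm{CP}(\mathcal H,\mathcal K)$ into $\mathrm{CP}(\mathcal H_2,\mathcal K_2)$. -/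

import Mathlib

open scoped MatrixOrder Matrix Topology ComplexOrder

/-! Finite-dimensional Hilbert spaces are `ℂ^n` with a finite index type `n`, so `B(ℂ^n)` is
`Matrix n n ℂ`, and `ℂ^m ⊗ ℂ^n` is `ℂ^(m × n)`.
`A ≤ B` for matrices is the Löwner (positive semidefinite) order. -/

namespace SuperPersp

/-! ### Operator convexity and the operator perspective -/

section Operator

variable {n : Type*} [Fintype n] [DecidableEq n]

/-- `f : (0, ∞) → ℝ` (only the values on `(0, ∞)` matter) is operator convex: on positive definite
matrices of every size, `A ↦ f(A)` is convex in the Löwner order. -/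
def OperatorConvex (f : ℝ → ℝ) : Prop :=
  ∀ d : ℕ, ∀ A B : Matrix (Fin d) (Fin d) ℂ, A.PosDef → B.PosDef →
    ∀ t : ℝ, 0 ≤ t → t ≤ 1 →
      cfc f (t • A + (1 - t) • B) ≤ t • cfc f A + (1 - t) • cfc f B

/-- `B^{1/2} f(B^{-1/2} A B^{-1/2}) B^{1/2}`, for positive definite `A` and `B`. -/
noncomputable def opPerspPos (f : ℝ → ℝ) (A B : Matrix n n ℂ) : Matrix n n ℂ :=
  cfc Real.sqrt B * cfc f ((cfc Real.sqrt B)⁻¹ * A * (cfc Real.sqrt B)⁻¹) * cfc Real.sqrt B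

/-- `P_f(A, B)` is defined, i.e. `lim_{ε ↘ 0} P_f(A + εI, B + εI)` exists. -/
def OpPerspDefined (f : ℝ → ℝ) (A B : Matrix n n ℂ) : Prop :=
  ∃ C : Matrix n n ℂ,
    Filter.Tendsto (fun ε : ℝ => opPerspPos f (A + ε • 1) (B + ε • 1)) (𝓝[>] 0) (𝓝 C)

/-- The operator perspective `P_f(A, B) = lim_{ε ↘ 0} P_f(A + εI, B + εI)` of positive
semidefinite `A` and `B` (meaningful if `OpPerspDefined f A B`). -/
noncomputable def opPersp (f : ℝ → ℝ) (A B : Matrix n n ℂ) : Matrix n n ℂ :=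
  Filter.limUnder (𝓝[>] (0 : ℝ)) (fun ε : ℝ => opPerspPos f (A + ε • 1) (B + ε • 1))

/-- `A^0`, the orthogonal projection onto the support `(ker A)^⊥` of a positive semidefinite `A`. -/
noncomputable def supp (A : Matrix n n ℂ) : Matrix n n ℂ :=
  cfc (fun x : ℝ => if x = 0 then 0 else 1) A

/-- `f(0⁺) := lim_{x ↘ 0} f(x) < +∞`. For a convex `f` the limit exists in `(-∞, +∞]`, so this says
that it is a real number. -/
def FiniteAtZero (f : ℝ → ℝ) : Prop :=
  ∃ c : ℝ, Filter.Tendsto f (𝓝[>] 0) (𝓝 c)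

/-- The transpose function `x ↦ x f(1/x)` of `f`. -/
noncomputable def transposeFun (f : ℝ → ℝ) : ℝ → ℝ := fun x => x * f (1 / x)

/-- At least one of the following holds: `A^0 = B^0`; or `f(0⁺) < ∞` and `f̃(0⁺) < ∞`; or
`f(0⁺) < ∞` and `A^0 ≤ B^0`; or `f̃(0⁺) < ∞` and `A^0 ≥ B^0`, where `f̃` is the transpose of `f`. -/
def SupportCondition (f : ℝ → ℝ) (A B : Matrix n n ℂ) : Prop :=
  supp A = supp B ∨
  (FiniteAtZero f ∧ FiniteAtZero (transposeFun f)) ∨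
  (FiniteAtZero f ∧ supp A ≤ supp B) ∨
  (FiniteAtZero (transposeFun f) ∧ supp B ≤ supp A)

end Operator

/-! ### Superoperators and complete positivity -/

/-- Superoperators: linear maps from `B(ℂ^n)` to `B(ℂ^k)`. -/
abbrev SuperOp (n k : Type*) : Type _ := Matrix n n ℂ →ₗ[ℂ] Matrix k k ℂ

section CP

open scoped Matrix.Norms.L2Operator

variable {n k : Type*} [Fintype n] [DecidableEq n] [Fintype k] [DecidableEq k]

/-- `N` is completely positive, i.e. `N ∈ CP(ℂ^n, ℂ^k)`. -/
def IsCP (N : SuperOp n k) : Prop :=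
  ∃ φ : CompletelyPositiveMap (Matrix n n ℂ) (Matrix k k ℂ), φ.toLinearMap = N

/-- The order `N ≤_CP M`. -/
def LECP (N M : SuperOp n k) : Prop := IsCP (M - N)

end CP

/-! ### Choi vectors, the Choi-Jamiołkowski isomorphism, and the superoperator perspective -/

section Choi

/-- The map `X ↦ (⟨a| ⊗ I) X (|b⟩ ⊗ I)` from `B(ℂ^m ⊗ ℂ^n)` to `B(ℂ^n)`. -/
def blockAt {m n : Type*} (a b : m) : Matrix (m × n) (m × n) ℂ →ₗ[ℂ] Matrix n n ℂ where
  toFun X := Matrix.of fun i j => X (a, i) (b, j)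
  map_add' _ _ := rfl
  map_smul' _ _ := rfl

/-- The map `x ↦ |a⟩⟨b| ⊗ x` from `B(ℂ^n)` to `B(ℂ^m ⊗ ℂ^n)`. -/
def embedAt {m n : Type*} [DecidableEq m] (a b : m) :
    Matrix n n ℂ →ₗ[ℂ] Matrix (m × n) (m × n) ℂ where
  toFun x := Matrix.kroneckerMap (· * ·) (Matrix.single a b (1 : ℂ)) x
  map_add' x y := by ext; simp [mul_add]
  map_smul' c x := by ext; simp [mul_left_comm]

/-- `id_{B(ℂ^m)} ⊗ N`. -/
def idTensor (m : Type*) [Fintype m] [DecidableEq m] {n k : Type*} (N : SuperOp n k) :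
    SuperOp (m × n) (m × k) :=
  ∑ a : m, ∑ b : m, embedAt a b ∘ₗ N ∘ₗ blockAt a b

/-- A Choi vector `Ψ = ∑ⱼ ẽⱼ ⊗ eⱼ ∈ ℂ^m ⊗ ℂ^n`, where `(eⱼ)` is an orthonormal basis of `ℂ^n` and
`(ẽⱼ)` is an orthonormal basis of `ℂ^m` (so `m` and `n` have the same number of elements). -/
structure ChoiVector (m n : Type*) [Fintype m] [Fintype n] where
  vec : m × n → ℂ
  isChoi : ∃ (e : OrthonormalBasis n ℂ (EuclideanSpace ℂ n))
    (e' : OrthonormalBasis n ℂ (EuclideanSpace ℂ m)),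
      ∀ a i, vec (a, i) = ∑ j, e' j a * e j i

variable {m n k : Type*} [Fintype m] [DecidableEq m] [Fintype n]

/-- The rank one operator `|Ψ⟩⟨Ψ|`. -/
def ChoiVector.proj (Ψ : ChoiVector m n) : Matrix (m × n) (m × n) ℂ :=
  Matrix.vecMulVec Ψ.vec (star Ψ.vec)

theorem blockAt_embedAt {m n : Type*} [DecidableEq m] (a b c d : m) (x : Matrix n n ℂ) :
    blockAt a b (embedAt c d x) = if c = a ∧ d = b then x else 0 := by
  ext i j
  have : blockAt a b (embedAt c d x) i j = Matrix.single c d (1 : ℂ) a b * x i j := rfl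
  rw [this, Matrix.single_apply]
  split_ifs <;> simp

theorem blockAt_idTensor {m n k : Type*} [Fintype m] [DecidableEq m] (N : SuperOp n k)
    (X : Matrix (m × n) (m × n) ℂ) (a b : m) :
    blockAt a b (idTensor m N X) = N (blockAt a b X) := by
  simp only [idTensor, LinearMap.sum_apply, LinearMap.comp_apply, map_sum, blockAt_embedAt]
  rw [Finset.sum_eq_single a, Finset.sum_eq_single b] <;> simp +contextual

theorem ext_block {m k : Type*} {X Y : Matrix (m × k) (m × k) ℂ}
    (h : ∀ a b, blockAt a b X = blockAt a b Y) : X = Y := by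
  ext ⟨a, i⟩ ⟨b, j⟩
  exact congrFun (congrFun (h a b) i) j

theorem ChoiVector.unitary [DecidableEq n] (Ψ : ChoiVector m n) :
    (Matrix.of fun a i => Ψ.vec (a, i))ᴴ * (Matrix.of fun a i => Ψ.vec (a, i)) = 1 ∧
    (Matrix.of fun a i => Ψ.vec (a, i)) * (Matrix.of fun a i => Ψ.vec (a, i))ᴴ = 1 := by
  obtain ⟨e, e', h⟩ := Ψ.isChoi
  have hcard : Fintype.card n = Fintype.card m := by
    have := Module.finrank_eq_card_basis e'.toBasis
    simpa using this.symm
  set E : Matrix n n ℂ := Matrix.of fun i j => e j i with hE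
  set F : Matrix m n ℂ := Matrix.of fun a j => e' j a with hF
  have hU : (Matrix.of fun a i => Ψ.vec (a, i)) = F * Eᵀ := by
    ext a i
    simp [Matrix.mul_apply, h, hE, hF]
  have hEE : Eᴴ * E = 1 := by
    ext i j
    have := (orthonormal_iff_ite.mp e.orthonormal) i j
    rw [Matrix.one_apply, ← this]
    simp [Matrix.mul_apply, hE, PiLp.inner_apply, mul_comm]
  have hFF : Fᴴ * F = 1 := by
    ext i j
    have := (orthonormal_iff_ite.mp e'.orthonormal) i j
    rw [Matrix.one_apply, ← this]
    simp [Matrix.mul_apply, hF, PiLp.inner_apply, mul_comm]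
  have hEE' : E * Eᴴ = 1 := mul_eq_one_comm.mp hEE
  have hT : (Eᵀ)ᴴ * Eᵀ = 1 := by
    have := congrArg Matrix.transpose hEE'
    simpa [Matrix.transpose_mul, Matrix.conjTranspose, Matrix.transpose_map] using this
  have h1 : (F * Eᵀ)ᴴ * (F * Eᵀ) = 1 := by
    rw [Matrix.conjTranspose_mul, Matrix.mul_assoc, ← Matrix.mul_assoc Fᴴ, hFF, Matrix.one_mul, hT]
  rw [hU]
  exact ⟨h1, (Matrix.mul_eq_one_comm_of_card_eq n m ℂ hcard).mp h1⟩

/-- The Choi-Jamiołkowski isomorphism `N ↦ (id ⊗ N)(|Ψ⟩⟨Ψ|)`. -/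
noncomputable def choi (Ψ : ChoiVector m n) : SuperOp n k ≃ₗ[ℂ] Matrix (m × k) (m × k) ℂ where
  toFun N := idTensor m N Ψ.proj
  map_add' N M := ext_block fun a b => by simp [blockAt_idTensor]
  map_smul' c N := ext_block fun a b => by simp [blockAt_idTensor]
  invFun X :=
    { toFun := fun ρ => ∑ a, ∑ b,
        (∑ i, ∑ j, star (Ψ.vec (a, i)) * ρ i j * Ψ.vec (b, j)) • blockAt a b X
      map_add' := fun ρ σ => by
        simp only [Matrix.add_apply, mul_add, add_mul, Finset.sum_add_distrib, add_smul]
      map_smul' := fun c ρ => by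
        simp only [Finset.smul_sum, smul_smul, RingHom.id_apply, Matrix.smul_apply, smul_eq_mul,
          Finset.mul_sum]
        refine Finset.sum_congr rfl fun a _ => Finset.sum_congr rfl fun b _ => ?_
        congr 1
        refine Finset.sum_congr rfl fun i _ => Finset.sum_congr rfl fun j _ => ?_
        ring }
  left_inv N := by
    classical
    obtain ⟨h1, -⟩ := Ψ.unitary
    refine LinearMap.ext fun ρ => ?_
    simp only [LinearMap.coe_mk, AddHom.coe_mk, blockAt_idTensor]
    simp only [← map_smul, ← map_sum]
    congr 1
    set U : Matrix m n ℂ := Matrix.of fun a i => Ψ.vec (a, i) with hU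
    have hT : Uᵀ * Uᴴᵀ = 1 := by rw [← Matrix.transpose_mul, h1, Matrix.transpose_one]
    have h3 : ρ = Uᵀ * (Uᴴᵀ * ρ * Uᵀ) * Uᴴᵀ := by
      rw [Matrix.mul_assoc, Matrix.mul_assoc _ Uᵀ, hT, Matrix.mul_one, ← Matrix.mul_assoc, hT,
        Matrix.one_mul]
    conv_rhs => rw [h3]
    have hc : ∀ a b, ∑ i, ∑ j, star (Ψ.vec (a, i)) * ρ i j * Ψ.vec (b, j)
        = (Uᴴᵀ * ρ * Uᵀ) a b := fun a b => by
      simp only [Matrix.mul_apply, Finset.sum_mul]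
      rw [Finset.sum_comm]
      rfl
    ext p q
    have hb : ∀ a b, blockAt a b Ψ.proj p q = Uᵀ p a * Uᴴᵀ b q := fun a b => rfl
    simp only [hc, Matrix.sum_apply]
    generalize Uᴴᵀ * ρ * Uᵀ = S
    rw [Matrix.mul_apply, Finset.sum_comm]
    refine Finset.sum_congr rfl fun b _ => ?_
    rw [Matrix.mul_apply, Finset.sum_mul]
    refine Finset.sum_congr rfl fun a _ => ?_
    rw [map_smul, Matrix.smul_apply, hb, smul_eq_mul]
    ring
  right_inv X := by
    classical
    obtain ⟨-, h2⟩ := Ψ.unitary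
    refine ext_block fun a b => ?_
    rw [blockAt_idTensor]
    simp only [LinearMap.coe_mk, AddHom.coe_mk]
    set U : Matrix m n ℂ := Matrix.of fun a i => Ψ.vec (a, i) with hU
    have hc : ∀ c d, ∑ i, ∑ j, star (Ψ.vec (c, i)) * blockAt a b Ψ.proj i j * Ψ.vec (d, j)
        = (if a = c then 1 else 0) * (if d = b then 1 else 0) := fun c d => by
      rw [← Matrix.one_apply, ← Matrix.one_apply, ← h2, Matrix.mul_apply, Matrix.mul_apply,
        Finset.sum_mul_sum]
      refine Finset.sum_congr rfl fun i _ => Finset.sum_congr rfl fun j _ => ?_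
      change star (Ψ.vec (c, i)) * (Ψ.vec (a, i) * star (Ψ.vec (b, j))) * Ψ.vec (d, j)
        = Ψ.vec (a, i) * star (Ψ.vec (c, i)) * (Ψ.vec (d, j) * star (Ψ.vec (b, j)))
      ring
    simp only [hc]
    rw [Finset.sum_eq_single a, Finset.sum_eq_single b] <;> simp +contextual [eq_comm]

/-- `P_f(N, M)` is defined (with respect to the Choi vector `Ψ`). -/
def SuperPerspDefined [Fintype k] [DecidableEq k] (Ψ : ChoiVector m n) (f : ℝ → ℝ)
    (N M : SuperOp n k) : Prop :=
  OpPerspDefined f (choi Ψ N) (choi Ψ M)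

/-- The superoperator perspective `P_f(N, M) = C_Ψ⁻¹(P_f(C_Ψ(N), C_Ψ(M)))`. -/
noncomputable def superPersp [Fintype k] [DecidableEq k] (Ψ : ChoiVector m n) (f : ℝ → ℝ)
    (N M : SuperOp n k) : SuperOp n k :=
  (choi Ψ).symm (opPersp f (choi Ψ N) (choi Ψ M))

end Choi

/-! ### Supermaps -/

section Supermap

variable {n₁ k₁ n₂ k₂ : Type*}

/-- Supermaps: linear maps from superoperators to superoperators. -/
abbrev Supermap (n₁ k₁ n₂ k₂ : Type*) : Type _ := SuperOp n₁ k₁ →ₗ[ℂ] SuperOp n₂ k₂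

/-- The action `(id ⊗ Θ)(Λ)` of `Θ` on half of a bipartite superoperator
`Λ : B(ℂ^r ⊗ ℂ^n₁) → B(ℂ^s ⊗ ℂ^k₁)`; it is the linear extension of `Γ ⊗ N ↦ Γ ⊗ Θ(N)`. -/
def Supermap.idTensor {r s : Type*} [Fintype r] [DecidableEq r] [Fintype s] [DecidableEq s]
    (Θ : Supermap n₁ k₁ n₂ k₂) (Λ : SuperOp (r × n₁) (s × k₁)) : SuperOp (r × n₂) (s × k₂) :=
  ∑ a : s, ∑ b : s, ∑ c : r, ∑ d : r,
    embedAt a b ∘ₗ Θ (blockAt a b ∘ₗ Λ ∘ₗ embedAt c d) ∘ₗ blockAt c d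

variable [Fintype n₁] [DecidableEq n₁] [Fintype k₁] [DecidableEq k₁]
  [Fintype n₂] [DecidableEq n₂] [Fintype k₂] [DecidableEq k₂]

/-- `Θ` maps completely positive superoperators to completely positive superoperators. -/
def Supermap.PreservesCP (Θ : Supermap n₁ k₁ n₂ k₂) : Prop :=
  ∀ Λ : SuperOp n₁ k₁, IsCP Λ → IsCP (Θ Λ)

/-- `Θ` is a completely positive supermap: acting on half of any bipartite completely positive
superoperator, it yields a completely positive superoperator. -/
def Supermap.IsCPSupermap (Θ : Supermap n₁ k₁ n₂ k₂) : Prop :=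
  ∀ (r s : ℕ) (Λ : SuperOp (Fin r × n₁) (Fin s × k₁)), IsCP Λ → IsCP (Θ.idTensor Λ)

end Supermap

end SuperPersp

open SuperPersp

/-!
Every claim is an instance of one fact about a positive linear map `T` between matrix algebras: if
`P_f(A, B)` is defined, then so is `P_f(T A, T B)`, and `P_f(T A, T B) ≤ T (P_f(A, B))`. Indeed, a
linear map of superoperators preserving complete positivity acts as a positive map on Choi matrices,
by Choi's theorem; pre- and post-processing and a change of Choi vector (`T` induced by the
identity) are such maps. Using the fact for a map and for its inverse yields equality.

For `B > 0`, the spectral decomposition `B^{-1/2} A B^{-1/2} = ∑ λᵢ Eᵢ` gives `Gᵢ ≥ 0` with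
`B = ∑ Gᵢ`, `A = ∑ λᵢ Gᵢ` and `P_f(A, B) = ∑ f(λᵢ) Gᵢ`. Applying `T` to each `Gᵢ`, the inequality
becomes Jensen's inequality `f(∑ λᵢ Fᵢ) ≤ ∑ f(λᵢ) Fᵢ` for operators `Fᵢ ≥ 0` with sum `1`; by
dilation this is `f(V* D V) ≤ V* f(D) V` for an isometry `V`, which is midpoint convexity at `D` and
its conjugate by the reflection `2VV* - 1`.

The same inequality with an extra term absorbing `ε I - δ T(I) ≥ 0` shows that
`P_f(A + εI, B + εI) - ε f(1) I` increases as `ε` decreases. The limit therefore exists as soon as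
these operators are bounded above, and the inequality passes to it as a supremum. Under each support
condition `f(x) ≤ K (1 + x)` on the spectra of the regularised relative operators, which bounds
`P_f(A + εI, B + εI)` by `K (A + B + 2εI)`.
-/

namespace SuperPersp

section FunctionalCalculus

variable {𝕜 n p : Type*} [RCLike 𝕜]

theorem conjTranspose_mul_mul_mono [Finite n] [Fintype p] {X Y : Matrix p p 𝕜} (h : X ≤ Y)
    (V : Matrix p n 𝕜) :
    Vᴴ * X * V ≤ Vᴴ * Y * V := by
  cases nonempty_fintype n
  rw [Matrix.le_iff] at h ⊢
  simpa only [Matrix.mul_sub, Matrix.sub_mul] using h.conjTranspose_mul_mul_same V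

theorem posDef_mul_mul_conjTranspose_of_mul_eq_one [Fintype n] [Finite p] [DecidableEq p]
    {X : Matrix n n 𝕜} (hX : X.PosDef) {V : Matrix p n 𝕜} {W : Matrix n p 𝕜} (hVW : V * W = 1) :
    (V * X * Vᴴ).PosDef := by
  cases nonempty_fintype p
  exact hX.mul_mul_conjTranspose_same <|
    Function.LeftInverse.injective (g := fun x ↦ Matrix.vecMul x W) fun x ↦ by
      simp only [Matrix.vecMul_vecMul, hVW, Matrix.vecMul_one]

variable [Fintype n] [DecidableEq n] [Fintype p] [DecidableEq p]

theorem exists_polynomial_eqOn_of_finite (f : ℝ → ℝ) {s : Set ℝ} (hs : s.Finite) :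
    ∃ q : Polynomial ℝ, s.EqOn f q.eval :=
  ⟨Lagrange.interpolate hs.toFinset id f, fun _ hx ↦
    (Lagrange.eval_interpolate_at_node f Function.injective_id.injOn
      (hs.mem_toFinset.mpr hx)).symm⟩

theorem aeval_mul_eq_mul_aeval {X : Matrix n n 𝕜} {Y : Matrix p p 𝕜} {V : Matrix p n 𝕜}
    (h : Y * V = V * X) (q : Polynomial ℝ) :
    Polynomial.aeval Y q * V = V * Polynomial.aeval X q := by
  have pow_mul : ∀ k : ℕ, Y ^ k * V = V * X ^ k := by
    intro k
    induction k with
    | zero => simp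
    | succ k ih =>
      rw [pow_succ, Matrix.mul_assoc, h, ← Matrix.mul_assoc, ih, Matrix.mul_assoc, ← pow_succ]
  induction q using Polynomial.induction_on' with
  | add a b ha hb => simp only [map_add, Matrix.add_mul, Matrix.mul_add, ha, hb]
  | monomial k r =>
    simp [Polynomial.aeval_monomial, Algebra.algebraMap_eq_smul_one, pow_mul]

theorem cfc_mul_eq_mul_cfc (f : ℝ → ℝ) {X : Matrix n n 𝕜} {Y : Matrix p p 𝕜} {V : Matrix p n 𝕜}
    (hX : X.IsHermitian) (hY : Y.IsHermitian) (h : Y * V = V * X) :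
    cfc f Y * V = V * cfc f X := by
  obtain ⟨q, hq⟩ := exists_polynomial_eqOn_of_finite f
    (X.finite_real_spectrum.union Y.finite_real_spectrum)
  rw [cfc_congr (hq.mono Set.subset_union_right), cfc_congr (hq.mono Set.subset_union_left),
    cfc_polynomial q X hX.isSelfAdjoint, cfc_polynomial q Y hY.isSelfAdjoint]
  exact aeval_mul_eq_mul_aeval h q

theorem cfc_mul_mul_of_mul_eq_one (f : ℝ → ℝ) {X : Matrix n n 𝕜} {V : Matrix p n 𝕜}
    (hX : X.IsHermitian) (hV : Vᴴ * V = 1) (hV' : V * Vᴴ = 1) :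
    cfc f (V * X * Vᴴ) = V * cfc f X * Vᴴ := by
  have intertwine : V * X * Vᴴ * V = V * X := by rw [Matrix.mul_assoc, hV, Matrix.mul_one]
  rw [← cfc_mul_eq_mul_cfc f hX (Matrix.isHermitian_mul_mul_conjTranspose V hX) intertwine,
    Matrix.mul_assoc _ V, hV', Matrix.mul_one]

theorem cfc_diagonal (f : ℝ → ℝ) (d : n → ℝ) :
    cfc f (Matrix.diagonal fun i ↦ (d i : 𝕜)) = Matrix.diagonal fun i ↦ (f (d i) : 𝕜) := by
  let φ : (n → ℝ) →ₐ[ℝ] Matrix n n 𝕜 :=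
    (Matrix.diagonalAlgHom ℝ).comp ((RCLike.ofRealAm (K := 𝕜)).compLeft n)
  have isSelfAdjoint : IsSelfAdjoint (φ d) :=
    Matrix.isHermitian_diagonal_of_self_adjoint _ (by ext; simp)
  obtain ⟨q, hq⟩ := exists_polynomial_eqOn_of_finite f
    ((φ d).finite_real_spectrum.union (Set.finite_range d))
  have aeval_eq : Polynomial.aeval d q = f ∘ d := by
    ext i
    simp [hq (Or.inr ⟨i, rfl⟩)]
  calc cfc f (φ d) = Polynomial.aeval (φ d) q := by
        rw [cfc_congr (hq.mono Set.subset_union_left), cfc_polynomial q _ isSelfAdjoint]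
    _ = φ (f ∘ d) := by rw [Polynomial.aeval_algHom_apply, aeval_eq]

end FunctionalCalculus

section Reflection

variable {𝕜 n p : Type*} [RCLike 𝕜] [Fintype n] [DecidableEq p]

/-- The reflection `2VV* - 1` in the range of an isometry `V`, by which Jensen's inequality is
reduced to midpoint convexity. -/
noncomputable def reflection (V : Matrix p n 𝕜) : Matrix p p 𝕜 := (2 : ℝ) • (V * Vᴴ) - 1

theorem isHermitian_reflection (V : Matrix p n 𝕜) : (reflection V).IsHermitian := by
  simp [Matrix.IsHermitian, reflection]

variable [Fintype p] [DecidableEq n] {V : Matrix p n 𝕜}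

theorem reflection_mul (hV : Vᴴ * V = 1) : reflection V * V = V := by
  rw [reflection, Matrix.sub_mul, Matrix.smul_mul, Matrix.mul_assoc, hV, Matrix.mul_one,
    Matrix.one_mul, two_smul, add_sub_cancel_right]

theorem reflection_mul_reflection (hV : Vᴴ * V = 1) : reflection V * reflection V = 1 := by
  nth_rw 2 [reflection]
  rw [Matrix.mul_sub, Matrix.mul_smul, ← Matrix.mul_assoc, reflection_mul hV, Matrix.mul_one,
    reflection, sub_sub_cancel]

theorem cfc_reflection_mul_mul_reflection (f : ℝ → ℝ) {D : Matrix p p 𝕜} (hD : D.IsHermitian)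
    (hV : Vᴴ * V = 1) :
    cfc f (reflection V * D * reflection V) = reflection V * cfc f D * reflection V := by
  have h := reflection_mul_reflection hV
  simpa only [(isHermitian_reflection V).eq] using
    cfc_mul_mul_of_mul_eq_one (V := reflection V) f hD
      (by rwa [(isHermitian_reflection V).eq]) (by rwa [(isHermitian_reflection V).eq])

theorem average_reflection_mul (D : Matrix p p 𝕜) (hV : Vᴴ * V = 1) :
    ((1 / 2 : ℝ) • D + (1 - 1 / 2 : ℝ) • (reflection V * D * reflection V)) * V =
      V * (Vᴴ * D * V) := by
  calc _ = (1 / 2 : ℝ) • ((1 + reflection V) * (D * V)) := by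
        simp only [Matrix.add_mul, Matrix.smul_mul, Matrix.mul_assoc, reflection_mul hV,
          Matrix.one_mul]
        norm_num
    _ = V * (Vᴴ * D * V) := by
        rw [reflection, add_sub_cancel, Matrix.smul_mul, smul_smul]
        norm_num [Matrix.mul_assoc]

theorem conjTranspose_mul_average_reflection_mul (D : Matrix p p 𝕜) (hV : Vᴴ * V = 1) :
    Vᴴ * ((1 / 2 : ℝ) • D + (1 - 1 / 2 : ℝ) • (reflection V * D * reflection V)) * V =
      Vᴴ * D * V := by
  rw [Matrix.mul_assoc, average_reflection_mul D hV, ← Matrix.mul_assoc, hV, Matrix.one_mul]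

end Reflection

section Jensen

variable {n p : Type*} [Fintype n] [DecidableEq n] [Fintype p] [DecidableEq p]

theorem OperatorConvex.cfc_add_le {f : ℝ → ℝ} (hf : OperatorConvex f) {A B : Matrix n n ℂ}
    (hA : A.PosDef) (hB : B.PosDef) {t : ℝ} (ht₀ : 0 ≤ t) (ht₁ : t ≤ 1) :
    cfc f (t • A + (1 - t) • B) ≤ t • cfc f A + (1 - t) • cfc f B := by
  let e := Fintype.equivFin n
  let V : Matrix (Fin (Fintype.card n)) n ℂ := (1 : Matrix n n ℂ).submatrix e.symm id
  have hV : Vᴴ * V = 1 := by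
    rw [Matrix.conjTranspose_submatrix, Matrix.submatrix_mul_equiv, Matrix.conjTranspose_one,
      Matrix.mul_one, Matrix.submatrix_id_id]
  have hV' : V * Vᴴ = 1 := by
    rw [Matrix.conjTranspose_submatrix, ← Matrix.submatrix_mul _ _ _ _ _ Function.bijective_id,
      Matrix.conjTranspose_one, Matrix.mul_one, Matrix.submatrix_one_equiv]
  have cancel (X : Matrix n n ℂ) : Vᴴ * (V * X * Vᴴ) * V = X := by
    simp only [Matrix.mul_assoc, hV, Matrix.mul_one]
    rw [← Matrix.mul_assoc, hV, Matrix.one_mul]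
  have posDef {X : Matrix n n ℂ} (hX : X.PosDef) : (V * X * Vᴴ).PosDef :=
    posDef_mul_mul_conjTranspose_of_mul_eq_one hX hV'
  have combine (X Y : Matrix n n ℂ) :
      t • (V * X * Vᴴ) + (1 - t) • (V * Y * Vᴴ) = V * (t • X + (1 - t) • Y) * Vᴴ := by
    simp only [Matrix.mul_add, Matrix.add_mul, Matrix.mul_smul, Matrix.smul_mul]
  have hAB : (t • A + (1 - t) • B).IsHermitian :=
    (hA.isHermitian.smul (IsSelfAdjoint.all _)).add
      (hB.isHermitian.smul (IsSelfAdjoint.all _))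
  have h := conjTranspose_mul_mul_mono (hf _ _ _ (posDef hA) (posDef hB) t ht₀ ht₁) V
  rwa [combine, cfc_mul_mul_of_mul_eq_one f hAB hV hV',
    cfc_mul_mul_of_mul_eq_one f hA.isHermitian hV hV',
    cfc_mul_mul_of_mul_eq_one f hB.isHermitian hV hV', combine, cancel, cancel] at h

theorem OperatorConvex.cfc_conjTranspose_mul_mul_le {f : ℝ → ℝ} (hf : OperatorConvex f)
    {D : Matrix p p ℂ} (hD : D.PosDef) {V : Matrix p n ℂ} (hV : Vᴴ * V = 1) :
    cfc f (Vᴴ * D * V) ≤ Vᴴ * cfc f D * V := by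
  set U := reflection V
  have hUDU : (U * D * U).PosDef := by
    simpa only [U, (isHermitian_reflection V).eq] using
      posDef_mul_mul_conjTranspose_of_mul_eq_one hD (reflection_mul_reflection hV)
  have hM : ((1 / 2 : ℝ) • D + (1 - 1 / 2 : ℝ) • (U * D * U)).IsHermitian :=
    (hD.isHermitian.smul (IsSelfAdjoint.all _)).add
      (hUDU.isHermitian.smul (IsSelfAdjoint.all _))
  calc cfc f (Vᴴ * D * V)
      = Vᴴ * cfc f ((1 / 2 : ℝ) • D + (1 - 1 / 2 : ℝ) • (U * D * U)) * V := by
        rw [Matrix.mul_assoc Vᴴ (cfc f _), cfc_mul_eq_mul_cfc f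
          (Matrix.isHermitian_conjTranspose_mul_mul V hD.isHermitian) hM
          (average_reflection_mul D hV), ← Matrix.mul_assoc, hV, Matrix.one_mul]
    _ ≤ Vᴴ * ((1 / 2 : ℝ) • cfc f D + (1 - 1 / 2 : ℝ) • cfc f (U * D * U)) * V :=
        conjTranspose_mul_mul_mono (hf.cfc_add_le hD hUDU (by norm_num) (by norm_num)) V
    _ = Vᴴ * cfc f D * V := by
        rw [cfc_reflection_mul_mul_reflection f hD.isHermitian hV,
          conjTranspose_mul_average_reflection_mul _ hV]

theorem OperatorConvex.cfc_sum_smul_le {f : ℝ → ℝ} (hf : OperatorConvex f) {ι : Type*}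
    [Fintype ι] {E : ι → Matrix n n ℂ} (hE : ∀ i, 0 ≤ E i) (hE₁ : ∑ i, E i = 1) {l : ι → ℝ}
    (hl : ∀ i, 0 < l i) :
    cfc f (∑ i, l i • E i) ≤ ∑ i, f (l i) • E i := by
  classical
  choose Y hY using fun i ↦ CStarAlgebra.nonneg_iff_eq_star_mul_self.mp (hE i)
  -- `V` is the Naimark dilation of `E`: it compresses `diag(l i) ⊗ 1` to `∑ i, l i • E i`.
  let V : Matrix (ι × n) n ℂ := Matrix.of fun a b ↦ Y a.1 a.2 b
  have dilate (g : ι → ℝ) :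
      Vᴴ * Matrix.diagonal (fun a : ι × n ↦ (g a.1 : ℂ)) * V = ∑ i, g i • E i := by
    ext a b
    rw [Matrix.mul_apply]
    simp only [Matrix.mul_diagonal]
    simp only [Matrix.mul_apply, Fintype.sum_prod_type, Matrix.sum_apply, Matrix.smul_apply, hY,
      Matrix.star_eq_conjTranspose, Finset.smul_sum, V, Matrix.conjTranspose_apply,
      Matrix.of_apply, Complex.real_smul]
    exact Finset.sum_congr rfl fun i _ ↦ Finset.sum_congr rfl fun c _ ↦ by ring
  have isometry : Vᴴ * V = 1 := by simpa [hE₁] using dilate 1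
  have jensen := hf.cfc_conjTranspose_mul_mul_le
    (D := Matrix.diagonal fun a : ι × n ↦ (l a.1 : ℂ))
    (Matrix.posDef_diagonal_iff.mpr fun a ↦ by exact_mod_cast hl a.1) isometry
  have h := cfc_diagonal (𝕜 := ℂ) f fun a : ι × n ↦ l a.1
  simp only [Complex.coe_algebraMap] at h
  rwa [h, dilate, dilate fun i ↦ f (l i)] at jensen

end Jensen

section Perspective

variable {n p : Type*} [Fintype n] [DecidableEq n] [Fintype p] [DecidableEq p]

theorem exists_cfc_eq_sum_smul {𝕜 : Type*} [RCLike 𝕜] {X : Matrix n n 𝕜} (hX : X.IsHermitian) :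
    ∃ (E : n → Matrix n n 𝕜) (l : n → ℝ), (∀ i, 0 ≤ E i) ∧ (∀ i, l i ∈ spectrum ℝ X) ∧
      ∀ g : ℝ → ℝ, cfc g X = ∑ i, g (l i) • E i := by
  let U : Matrix n n 𝕜 := hX.eigenvectorUnitary
  refine ⟨fun i ↦ U * Matrix.single i i 1 * Uᴴ, hX.eigenvalues, fun i ↦ ?_,
    hX.eigenvalues_mem_spectrum_real, fun g ↦ ?_⟩
  · have posSemidef : (Matrix.single i i (1 : 𝕜)).PosSemidef := by
      rw [← Matrix.diagonal_single]
      exact Matrix.PosSemidef.diagonal (Pi.single_nonneg.mpr zero_le_one)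
    exact (posSemidef.mul_mul_conjTranspose_same U).nonneg
  · have diagonal_eq_sum : Matrix.diagonal (fun i ↦ (g (hX.eigenvalues i) : 𝕜)) =
        ∑ i, g (hX.eigenvalues i) • Matrix.single i i (1 : 𝕜) := by
      simp [Matrix.smul_single, Matrix.sum_single_eq_diagonal, RCLike.real_smul_eq_coe_mul]
    calc cfc g X = U * Matrix.diagonal (fun i ↦ (g (hX.eigenvalues i) : 𝕜)) * Uᴴ := by
          rw [hX.cfc_eq, Matrix.IsHermitian.cfc, Unitary.conjStarAlgAut_apply]
          rfl
      _ = _ := by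
          simp only [diagonal_eq_sum, Matrix.mul_sum, Matrix.sum_mul, Matrix.mul_smul,
            Matrix.smul_mul]

theorem cfc_sqrt_mul_cfc_sqrt {B : Matrix n n ℂ} (hB : 0 ≤ B) :
    cfc Real.sqrt B * cfc Real.sqrt B = B := by
  rw [← cfc_mul Real.sqrt Real.sqrt B]
  conv_rhs => rw [← cfc_id ℝ B hB.isSelfAdjoint]
  exact cfc_congr fun x hx ↦ Real.mul_self_sqrt (spectrum_nonneg_of_nonneg hB hx)

theorem posDef_cfc_sqrt {B : Matrix n n ℂ} (hB : B.PosDef) : (cfc Real.sqrt B).PosDef := by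
  have nonneg : 0 ≤ cfc Real.sqrt B := cfc_nonneg fun x _ ↦ Real.sqrt_nonneg x
  rw [(Matrix.nonneg_iff_posSemidef.mp nonneg).posDef_iff_isUnit]
  refine isUnit_of_mul_isUnit_left (y := cfc Real.sqrt B) ?_
  rw [cfc_sqrt_mul_cfc_sqrt hB.posSemidef.nonneg]
  exact hB.isUnit

theorem cfc_sqrt_mul_inv {B : Matrix n n ℂ} (hB : B.PosDef) :
    cfc Real.sqrt B * (cfc Real.sqrt B)⁻¹ = 1 :=
  Matrix.mul_nonsing_inv _ ((Matrix.isUnit_iff_isUnit_det _).mp (posDef_cfc_sqrt hB).isUnit)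

theorem inv_mul_cfc_sqrt {B : Matrix n n ℂ} (hB : B.PosDef) :
    (cfc Real.sqrt B)⁻¹ * cfc Real.sqrt B = 1 :=
  Matrix.nonsing_inv_mul _ ((Matrix.isUnit_iff_isUnit_det _).mp (posDef_cfc_sqrt hB).isUnit)

theorem isHermitian_cfc_sqrt (B : Matrix n n ℂ) : (cfc Real.sqrt B).IsHermitian :=
  cfc_predicate Real.sqrt B

/-- The relative operator `B^{-1/2} A B^{-1/2}` of `A` with respect to a positive definite `B`,
whose functional calculus defines the perspective. -/
noncomputable def relOp (A B : Matrix n n ℂ) : Matrix n n ℂ :=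
  (cfc Real.sqrt B)⁻¹ * A * (cfc Real.sqrt B)⁻¹

theorem isHermitian_relOp {A : Matrix n n ℂ} (hA : A.IsHermitian) (B : Matrix n n ℂ) :
    (relOp A B).IsHermitian := by
  simpa only [relOp, (isHermitian_cfc_sqrt B).inv.eq] using
    Matrix.isHermitian_conjTranspose_mul_mul (cfc Real.sqrt B)⁻¹ hA

theorem posDef_relOp {A B : Matrix n n ℂ} (hA : A.PosDef) (hB : B.PosDef) :
    (relOp A B).PosDef := by
  simpa only [relOp, (isHermitian_cfc_sqrt B).inv.eq] using
    posDef_mul_mul_conjTranspose_of_mul_eq_one hA (inv_mul_cfc_sqrt hB)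

theorem relOp_mono {A A' : Matrix n n ℂ} (h : A ≤ A') (B : Matrix n n ℂ) :
    relOp A B ≤ relOp A' B := by
  simpa only [relOp, (isHermitian_cfc_sqrt B).inv.eq] using
    conjTranspose_mul_mul_mono h (cfc Real.sqrt B)⁻¹

theorem relOp_self {B : Matrix n n ℂ} (hB : B.PosDef) : relOp B B = 1 := by
  calc relOp B B = (cfc Real.sqrt B)⁻¹ * (cfc Real.sqrt B * cfc Real.sqrt B) *
        (cfc Real.sqrt B)⁻¹ := by rw [cfc_sqrt_mul_cfc_sqrt hB.posSemidef.nonneg, relOp]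
    _ = 1 := by
      rw [← Matrix.mul_assoc, inv_mul_cfc_sqrt hB, Matrix.one_mul, cfc_sqrt_mul_inv hB]

theorem cfc_sqrt_mul_relOp_mul (A : Matrix n n ℂ) {B : Matrix n n ℂ} (hB : B.PosDef) :
    cfc Real.sqrt B * relOp A B * cfc Real.sqrt B = A := by
  rw [relOp, Matrix.mul_assoc, Matrix.mul_assoc _ _ (cfc Real.sqrt B), inv_mul_cfc_sqrt hB,
    Matrix.mul_one, ← Matrix.mul_assoc, cfc_sqrt_mul_inv hB, Matrix.one_mul]

theorem opPerspPos_const_one {A B : Matrix n n ℂ} (hA : A.IsHermitian) (hB : 0 ≤ B) :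
    opPerspPos (fun _ ↦ 1) A B = B := by
  change cfc Real.sqrt B * cfc (fun _ ↦ 1) (relOp A B) * cfc Real.sqrt B = B
  rw [cfc_const_one ℝ (relOp A B) (isHermitian_relOp hA B).isSelfAdjoint, Matrix.mul_one,
    cfc_sqrt_mul_cfc_sqrt hB]

theorem opPerspPos_id {A B : Matrix n n ℂ} (hA : A.IsHermitian) (hB : B.PosDef) :
    opPerspPos id A B = A := by
  change cfc Real.sqrt B * cfc id (relOp A B) * cfc Real.sqrt B = A
  rw [cfc_id ℝ (relOp A B) (isHermitian_relOp hA B).isSelfAdjoint, cfc_sqrt_mul_relOp_mul A hB]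

theorem exists_opPerspPos_eq_sum_smul {A : Matrix n n ℂ} (hA : A.IsHermitian)
    (B : Matrix n n ℂ) :
    ∃ (G : n → Matrix n n ℂ) (l : n → ℝ), (∀ i, 0 ≤ G i) ∧ (∀ i, l i ∈ spectrum ℝ (relOp A B)) ∧
      ∀ g : ℝ → ℝ, opPerspPos g A B = ∑ i, g (l i) • G i := by
  obtain ⟨E, l, hE, hl, cfc_eq⟩ := exists_cfc_eq_sum_smul (isHermitian_relOp hA B)
  refine ⟨fun i ↦ cfc Real.sqrt B * E i * cfc Real.sqrt B, l, fun i ↦ ?_, hl, fun g ↦ ?_⟩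
  · exact (isHermitian_cfc_sqrt B).isSelfAdjoint.conjugate_nonneg (hE i)
  · change cfc Real.sqrt B * cfc g (relOp A B) * cfc Real.sqrt B = _
    simp only [cfc_eq, Matrix.mul_sum, Matrix.sum_mul, Matrix.mul_smul, Matrix.smul_mul]

theorem OperatorConvex.opPerspPos_sum_smul_le {f : ℝ → ℝ} (hf : OperatorConvex f) {ι : Type*}
    [Fintype ι] {G : ι → Matrix n n ℂ} (hG : ∀ i, 0 ≤ G i) (hsum : (∑ i, G i).PosDef)
    {l : ι → ℝ} (hl : ∀ i, 0 < l i) :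
    opPerspPos f (∑ i, l i • G i) (∑ i, G i) ≤ ∑ i, f (l i) • G i := by
  have relOp_sum (g : ι → ℝ) : relOp (∑ i, g i • G i) (∑ i, G i) =
      ∑ i, g i • relOp (G i) (∑ i, G i) := by
    simp only [relOp, Matrix.mul_sum, Matrix.sum_mul, Matrix.mul_smul, Matrix.smul_mul]
  have nonneg (i : ι) : 0 ≤ relOp (G i) (∑ i, G i) := by
    simpa [relOp] using relOp_mono (hG i) (∑ i, G i)
  have sum_eq_one : ∑ i, relOp (G i) (∑ i, G i) = 1 := by
    simpa [relOp_self hsum] using (relOp_sum 1).symm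
  have jensen := conjTranspose_mul_mul_mono (hf.cfc_sum_smul_le nonneg sum_eq_one hl)
    (cfc Real.sqrt (∑ i, G i))
  rwa [(isHermitian_cfc_sqrt _).eq, ← relOp_sum, ← relOp_sum fun i ↦ f (l i),
    cfc_sqrt_mul_relOp_mul _ hsum] at jensen

theorem OperatorConvex.opPerspPos_map_add_le {f : ℝ → ℝ} (hf : OperatorConvex f)
    (T : Matrix n n ℂ →ₚ[ℂ] Matrix p p ℂ) {A B : Matrix n n ℂ} {X : Matrix p p ℂ}
    (hA : A.PosDef) (hB : B.PosDef) (hX : 0 ≤ X) (hBX : (T B + X).PosDef) :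
    opPerspPos f (T A + X) (T B + X) ≤ T (opPerspPos f A B) + f 1 • X := by
  obtain ⟨G, l, hG, hl, opPersp_eq⟩ := exists_opPerspPos_eq_sum_smul hA.isHermitian B
  have l_pos (i : n) : 0 < l i := (posDef_relOp hA hB).isStrictlyPositive.spectrum_pos (hl i)
  -- `X` joins the images of the spectral atoms of `relOp A B` as one more atom, of weight `1`.
  have sum_eq (g : ℝ → ℝ) : ∑ i : Option n, g (i.elim 1 l) • i.elim X (T ∘ G) =
      T (opPerspPos g A B) + g 1 • X := by
    simp [opPersp_eq, Fintype.sum_option, add_comm]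
  have sum_l : ∑ i : Option n, i.elim 1 l • i.elim X (T ∘ G) = T A + X := by
    simpa [opPerspPos_id hA.isHermitian hB] using sum_eq id
  have sum_one : ∑ i : Option n, i.elim X (T ∘ G) = T B + X := by
    simpa [opPerspPos_const_one hA.isHermitian hB.posSemidef.nonneg] using sum_eq fun _ ↦ 1
  have jensen := hf.opPerspPos_sum_smul_le (G := fun i : Option n ↦ i.elim X (T ∘ G))
    (l := fun i ↦ i.elim 1 l) (Option.rec hX fun i ↦ map_nonneg T (hG i)) (by rwa [sum_one])
    (Option.rec one_pos l_pos)
  rwa [sum_l, sum_one, sum_eq] at jensen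

end Perspective

section Limit

open Filter Set

section Order

variable {ι α : Type*} [TopologicalSpace α] [PartialOrder α] [OrderClosedTopology α]

theorem isLUB_of_mapClusterPt {l : Filter ι} {s : Set ι} {g : ι → α} {a : α} (hs : s ∈ l)
    (hg : ∀ i ∈ s, ∀ᶠ j in l, g i ≤ g j) (ha : MapClusterPt a l g) : IsLUB (g '' s) a := by
  constructor
  · rintro _ ⟨i, hi, rfl⟩
    exact isClosed_Ici.mem_of_mapClusterPt ha (hg i hi)
  · intro b hb
    exact isClosed_Iic.mem_of_mapClusterPt ha
      (mem_of_superset hs fun j hj ↦ hb (mem_image_of_mem g hj))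

theorem exists_tendsto_of_bddAbove [CompactIccSpace α] {l : Filter ι} [l.NeBot] {s : Set ι}
    {g : ι → α} (hs : s ∈ l) (hg : ∀ i ∈ s, ∀ᶠ j in l, g i ≤ g j) (hbdd : BddAbove (g '' s)) :
    ∃ a, Tendsto g l (𝓝 a) := by
  obtain ⟨i, hi⟩ := Filter.nonempty_of_mem hs
  obtain ⟨b, hb⟩ := hbdd
  have mem_Icc : ∀ᶠ j in l, g j ∈ Icc (g i) b := by
    filter_upwards [hg i hi, hs] with j hij hj using ⟨hij, hb (mem_image_of_mem g hj)⟩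
  obtain ⟨a, -, ha⟩ := isCompact_Icc.exists_mapClusterPt_of_frequently mem_Icc.frequently
  have hlub := isLUB_of_mapClusterPt hs hg ha
  exact ⟨a, isCompact_Icc.tendsto_nhds_of_unique_mapClusterPt mem_Icc fun c _ hc ↦
    (isLUB_of_mapClusterPt hs hg hc).unique hlub⟩

end Order

theorem compactIccSpace_of_properSpace {A : Type*} [CStarAlgebra A] [PartialOrder A]
    [StarOrderedRing A] [ProperSpace A] : CompactIccSpace A where
  isCompact_Icc {a b} := by
    refine Metric.isCompact_of_isClosed_isBounded isClosed_Icc ?_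
    refine Metric.isBounded_closedBall (x := a) (r := ‖b - a‖) |>.subset fun x hx ↦ ?_
    rw [Metric.mem_closedBall, dist_eq_norm]
    exact CStarAlgebra.norm_le_norm_of_nonneg_of_le (sub_nonneg.mpr hx.1)
      (sub_le_sub_right hx.2 a)

section Norm

open scoped Matrix.Norms.L2Operator

variable {n : Type*} [Finite n]

instance : CompactIccSpace (Matrix n n ℂ) := by
  classical
  cases nonempty_fintype n
  exact compactIccSpace_of_properSpace

instance : OrderClosedTopology (Matrix n n ℂ) := by
  classical
  cases nonempty_fintype n
  infer_instance

theorem exists_smul_le_smul_one [DecidableEq n] {X : Matrix n n ℂ} (hX : X.IsHermitian) {ε : ℝ}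
    (hε : 0 < ε) :
    ∃ δ > (0 : ℝ), δ • X ≤ ε • (1 : Matrix n n ℂ) := by
  cases nonempty_fintype n
  have hX_le : X ≤ ‖X‖ • (1 : Matrix n n ℂ) := by
    simpa [Algebra.algebraMap_eq_smul_one] using hX.isSelfAdjoint.le_algebraMap_norm_self
  have norm_pos : 0 < ‖X‖ + 1 := by positivity
  refine ⟨ε / (‖X‖ + 1), div_pos hε norm_pos, ?_⟩
  calc (ε / (‖X‖ + 1)) • X ≤ (ε / (‖X‖ + 1)) • ‖X‖ • (1 : Matrix n n ℂ) := by gcongr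
    _ = (ε * (‖X‖ / (‖X‖ + 1))) • (1 : Matrix n n ℂ) := by rw [smul_smul]; congr 1; ring
    _ ≤ ε • (1 : Matrix n n ℂ) := by
      refine smul_le_smul_of_nonneg_right ?_ zero_le_one
      exact mul_le_of_le_one_right hε.le (div_le_one_of_le₀ (by linarith) norm_pos.le)

end Norm

variable {n p : Type*} [Fintype n] [DecidableEq n] [Fintype p] [DecidableEq p]

theorem posDef_add_smul_one {𝕜 ι : Type*} [RCLike 𝕜] [DecidableEq ι] {A : Matrix ι ι 𝕜}
    (hA : 0 ≤ A) {ε : ℝ} (hε : 0 < ε) : (A + ε • 1).PosDef :=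
  Matrix.PosDef.posSemidef_add (Matrix.nonneg_iff_posSemidef.mp hA) (Matrix.PosDef.one.smul hε)

/-- The regularised perspective `P_f(A + εI, B + εI)`, normalised by subtracting
`P_f(εI, εI) = ε f(1) I`, which makes it antitone in `ε` for operator convex `f`. -/
noncomputable def regPersp (f : ℝ → ℝ) (A B : Matrix n n ℂ) (ε : ℝ) : Matrix n n ℂ :=
  opPerspPos f (A + ε • 1) (B + ε • 1) - (ε * f 1) • 1

theorem opPerspPos_eq_regPersp_add (f : ℝ → ℝ) (A B : Matrix n n ℂ) (ε : ℝ) :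
    opPerspPos f (A + ε • 1) (B + ε • 1) = regPersp f A B ε + (ε * f 1) • 1 :=
  (sub_add_cancel _ _).symm

theorem tendsto_regPersp_iff {f : ℝ → ℝ} {A B C : Matrix n n ℂ} :
    Tendsto (regPersp f A B) (𝓝[>] 0) (𝓝 C) ↔
      Tendsto (fun ε : ℝ ↦ opPerspPos f (A + ε • 1) (B + ε • 1)) (𝓝[>] 0) (𝓝 C) := by
  have vanishing : Tendsto (fun ε : ℝ ↦ (ε * f 1) • (1 : Matrix n n ℂ)) (𝓝[>] 0) (𝓝 0) := by
    refine Tendsto.mono_left (Continuous.tendsto' (by fun_prop) 0 0 (by simp)) nhdsWithin_le_nhds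
  constructor <;> intro h
  · simpa only [← opPerspPos_eq_regPersp_add, add_zero] using h.add vanishing
  · simpa only [sub_zero] using! h.sub vanishing

theorem OperatorConvex.regPersp_map_le {f : ℝ → ℝ} (hf : OperatorConvex f)
    (T : Matrix n n ℂ →ₚ[ℂ] Matrix p p ℂ) {A B : Matrix n n ℂ} (hA : 0 ≤ A) (hB : 0 ≤ B)
    {δ ε : ℝ} (hδ : 0 < δ) (hε : 0 < ε) (h : δ • T 1 ≤ ε • 1) :
    regPersp f (T A) (T B) ε ≤ T (regPersp f A B δ) := by
  have map_add_eq (Z : Matrix n n ℂ) : T (Z + δ • 1) + (ε • 1 - δ • T 1) = T Z + ε • 1 := by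
    simp
  have persp_le := hf.opPerspPos_map_add_le T (posDef_add_smul_one hA hδ)
    (posDef_add_smul_one hB hδ) (sub_nonneg.mpr h)
    (by rw [map_add_eq]; exact posDef_add_smul_one (map_nonneg T hB) hε)
  rw [map_add_eq, map_add_eq, opPerspPos_eq_regPersp_add f A B, map_add] at persp_le
  refine sub_le_iff_le_add.mpr (persp_le.trans_eq ?_)
  rw [PositiveLinearMap.map_smul_of_tower]
  module

theorem OperatorConvex.regPersp_antitoneOn {f : ℝ → ℝ} (hf : OperatorConvex f) {A B : Matrix n n ℂ}
    (hA : 0 ≤ A) (hB : 0 ≤ B) : AntitoneOn (regPersp f A B) (Ioi 0) := by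
  intro δ hδ ε hε hδε
  exact hf.regPersp_map_le (PositiveLinearMap.id ℂ (Matrix n n ℂ)) hA hB hδ hε
    (smul_le_smul_of_nonneg_right hδε zero_le_one)

theorem OperatorConvex.eventually_regPersp_le {f : ℝ → ℝ} (hf : OperatorConvex f)
    {A B : Matrix n n ℂ} (hA : 0 ≤ A) (hB : 0 ≤ B) :
    ∀ ε ∈ Ioi (0 : ℝ), ∀ᶠ δ in 𝓝[>] 0, regPersp f A B ε ≤ regPersp f A B δ := fun ε hε ↦ by
  filter_upwards [Ioc_mem_nhdsGT hε] with δ hδ using hf.regPersp_antitoneOn hA hB hδ.1 hε hδ.2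

theorem OpPerspDefined.tendsto_regPersp {f : ℝ → ℝ} {A B : Matrix n n ℂ}
    (h : OpPerspDefined f A B) : Tendsto (regPersp f A B) (𝓝[>] 0) (𝓝 (opPersp f A B)) :=
  tendsto_regPersp_iff.mpr (tendsto_nhds_limUnder h)

theorem OperatorConvex.isLUB_opPersp {f : ℝ → ℝ} (hf : OperatorConvex f) {A B : Matrix n n ℂ}
    (hA : 0 ≤ A) (hB : 0 ≤ B) (h : OpPerspDefined f A B) :
    IsLUB (regPersp f A B '' Ioi 0) (opPersp f A B) :=
  isLUB_of_mapClusterPt self_mem_nhdsWithin (hf.eventually_regPersp_le hA hB)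
    h.tendsto_regPersp.mapClusterPt

theorem OperatorConvex.opPerspDefined_of_bddAbove {f : ℝ → ℝ} (hf : OperatorConvex f)
    {A B : Matrix n n ℂ} (hA : 0 ≤ A) (hB : 0 ≤ B)
    (hbdd : BddAbove (regPersp f A B '' Ioi 0)) : OpPerspDefined f A B := by
  obtain ⟨C, hC⟩ := exists_tendsto_of_bddAbove self_mem_nhdsWithin
    (hf.eventually_regPersp_le hA hB) hbdd
  exact ⟨C, tendsto_regPersp_iff.mp hC⟩

theorem OperatorConvex.regPersp_map_le_map_opPersp {f : ℝ → ℝ} (hf : OperatorConvex f)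
    (T : Matrix n n ℂ →ₚ[ℂ] Matrix p p ℂ) {A B : Matrix n n ℂ} (hA : 0 ≤ A) (hB : 0 ≤ B)
    (h : OpPerspDefined f A B) {ε : ℝ} (hε : 0 < ε) :
    regPersp f (T A) (T B) ε ≤ T (opPersp f A B) := by
  obtain ⟨δ, hδ, hle⟩ := exists_smul_le_smul_one
    (Matrix.nonneg_iff_posSemidef.mp (map_nonneg T zero_le_one)).isHermitian hε
  exact (hf.regPersp_map_le T hA hB hδ hε hle).trans
    (OrderHomClass.mono T ((hf.isLUB_opPersp hA hB h).1 (mem_image_of_mem _ hδ)))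

theorem OperatorConvex.opPerspDefined_map {f : ℝ → ℝ} (hf : OperatorConvex f)
    (T : Matrix n n ℂ →ₚ[ℂ] Matrix p p ℂ) {A B : Matrix n n ℂ} (hA : 0 ≤ A) (hB : 0 ≤ B)
    (h : OpPerspDefined f A B) : OpPerspDefined f (T A) (T B) :=
  hf.opPerspDefined_of_bddAbove (map_nonneg T hA) (map_nonneg T hB)
    ⟨T (opPersp f A B), forall_mem_image.mpr fun _ ↦ hf.regPersp_map_le_map_opPersp T hA hB h⟩

theorem OperatorConvex.opPersp_map_le {f : ℝ → ℝ} (hf : OperatorConvex f)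
    (T : Matrix n n ℂ →ₚ[ℂ] Matrix p p ℂ) {A B : Matrix n n ℂ} (hA : 0 ≤ A) (hB : 0 ≤ B)
    (h : OpPerspDefined f A B) : opPersp f (T A) (T B) ≤ T (opPersp f A B) :=
  (isLUB_le_iff <| hf.isLUB_opPersp (map_nonneg T hA) (map_nonneg T hB)
    (hf.opPerspDefined_map T hA hB h)).mpr <|
    forall_mem_image.mpr fun _ ↦ hf.regPersp_map_le_map_opPersp T hA hB h

end Limit

section Growth

open Filter Set

variable {f : ℝ → ℝ}

theorem OperatorConvex.convexOn (hf : OperatorConvex f) : ConvexOn ℝ (Ioi 0) f := by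
  refine ⟨convex_Ioi 0, fun x hx y hy a b ha hb hab ↦ ?_⟩
  have hpos : ∀ {z : ℝ}, 0 < z → (algebraMap ℝ (Matrix (Fin 1) (Fin 1) ℂ) z).PosDef := fun hz ↦ by
    rw [Algebra.algebraMap_eq_smul_one]
    exact Matrix.PosDef.one.smul hz
  have h := hf 1 _ _ (hpos hx) (hpos hy) a ha (by linarith)
  rwa [← eq_sub_of_add_eq' hab, Algebra.smul_def, Algebra.smul_def, ← map_mul, ← map_mul,
    ← map_add, cfc_algebraMap, cfc_algebraMap, cfc_algebraMap, Algebra.smul_def, Algebra.smul_def,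
    ← map_mul, ← map_mul, ← map_add, algebraMap_le_algebraMap] at h

theorem OperatorConvex.continuousOn (hf : OperatorConvex f) : ContinuousOn f (Ioi 0) :=
  hf.convexOn.continuousOn isOpen_Ioi

theorem continuousOn_transposeFun (hf : ContinuousOn f (Ioi 0)) :
    ContinuousOn (transposeFun f) (Ioi 0) :=
  continuousOn_id.mul <| hf.comp (continuousOn_const.div continuousOn_id fun _ hx ↦ ne_of_gt hx)
    fun _ hx ↦ mem_Ioi.mpr (one_div_pos.mpr hx)

/-- `f x ≤ K (1 + x)` on `s` for some `K`, phrased for sets `s` of nonnegative numbers. This is the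
growth condition under which `P_f(A, B) ≤ K (A + B)`. -/
def LinearlyBoundedAboveOn (f : ℝ → ℝ) (s : Set ℝ) : Prop :=
  BddAbove ((fun x ↦ f x / (1 + x)) '' s)

theorem LinearlyBoundedAboveOn.union {s t : Set ℝ} (hs : LinearlyBoundedAboveOn f s)
    (ht : LinearlyBoundedAboveOn f t) : LinearlyBoundedAboveOn f (s ∪ t) := by
  rw [LinearlyBoundedAboveOn, image_union]
  exact BddAbove.union hs ht

theorem LinearlyBoundedAboveOn.mono {s t : Set ℝ} (ht : LinearlyBoundedAboveOn f t) (h : s ⊆ t) :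
    LinearlyBoundedAboveOn f s :=
  BddAbove.mono (image_mono h) ht

theorem linearlyBoundedAboveOn_Icc (hf : ContinuousOn f (Ioi 0)) {a : ℝ} (ha : 0 < a) (b : ℝ) :
    LinearlyBoundedAboveOn f (Icc a b) := by
  have hpos : ∀ x ∈ Icc a b, 0 < x := fun x hx ↦ ha.trans_le hx.1
  exact isCompact_Icc.bddAbove_image <| (hf.mono hpos).div (by fun_prop) fun x hx ↦
    (add_pos one_pos (hpos x hx)).ne'

theorem FiniteAtZero.linearlyBoundedAboveOn_Ioc (h : FiniteAtZero f) (hf : ContinuousOn f (Ioi 0))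
    (b : ℝ) : LinearlyBoundedAboveOn f (Ioc 0 b) := by
  obtain ⟨c, hc⟩ := h
  have hlim : Tendsto (fun x : ℝ ↦ f x / (1 + x)) (𝓝[>] 0) (𝓝 (c / (1 + 0))) :=
    hc.div (tendsto_const_nhds.add (tendsto_nhdsWithin_of_tendsto_nhds tendsto_id)) (by simp)
  obtain ⟨a, ha, hsub⟩ :=
    mem_nhdsGT_iff_exists_Ioo_subset.mp (hlim.eventually_le_const (lt_add_one _))
  have hnear : LinearlyBoundedAboveOn f (Ioo 0 a) := ⟨_, forall_mem_image.mpr hsub⟩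
  refine (hnear.union (linearlyBoundedAboveOn_Icc hf ha b)).mono fun x hx ↦ ?_
  exact (lt_or_ge x a).imp (fun h ↦ ⟨hx.1, h⟩) fun h ↦ ⟨h, hx.2⟩

-- The substitution `x ↦ 1 / x` turns `f x / (1 + x)` into the same quotient for the transpose.
theorem FiniteAtZero.linearlyBoundedAboveOn_Ici (h : FiniteAtZero (transposeFun f))
    (hf : ContinuousOn f (Ioi 0)) {a : ℝ} (ha : 0 < a) : LinearlyBoundedAboveOn f (Ici a) := by
  obtain ⟨K, hK⟩ := h.linearlyBoundedAboveOn_Ioc (continuousOn_transposeFun hf) (1 / a)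
  refine ⟨K, forall_mem_image.mpr fun x hx ↦ ?_⟩
  have hx0 : 0 < x := ha.trans_le hx
  have heq : f x / (1 + x) = transposeFun f (1 / x) / (1 + 1 / x) := by
    rw [transposeFun, one_div_one_div]
    field_simp
    ring
  rw [heq]
  exact hK (mem_image_of_mem _ ⟨one_div_pos.mpr hx0, one_div_le_one_div_of_le ha hx⟩)

theorem FiniteAtZero.linearlyBoundedAboveOn_Ioi (h : FiniteAtZero f)
    (h' : FiniteAtZero (transposeFun f)) (hf : ContinuousOn f (Ioi 0)) :
    LinearlyBoundedAboveOn f (Ioi 0) := by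
  rw [← Ioc_union_Ici_eq_Ioi (zero_lt_one' ℝ)]
  exact (h.linearlyBoundedAboveOn_Ioc hf 1).union (h'.linearlyBoundedAboveOn_Ici hf one_pos)

end Growth

section Support

open Set

variable {n p : Type*} [Fintype n] [DecidableEq n] [Fintype p] [DecidableEq p]

section StarProjection

variable {A : Type*} [NonUnitalCStarAlgebra A] [PartialOrder A] [StarOrderedRing A]

theorem starProjection_le_of_le_smul {p q : A} (hp : IsStarProjection p) (hq : IsStarProjection q)
    {c : ℝ} (hc : 0 < c) (h : p ≤ c • q) : p ≤ q := by
  have smul_le : c⁻¹ • p ≤ q := by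
    simpa [smul_smul, inv_mul_cancel₀ hc.ne'] using
      smul_le_smul_of_nonneg_left h (inv_nonneg.mpr hc.le)
  have absorb := (hq.mul_right_and_mul_left_of_nonneg_of_le
    (smul_nonneg (inv_nonneg.mpr hc.le) hp.nonneg) smul_le).2
  rw [mul_smul_comm] at absorb
  exact (hp.le_iff_mul_eq_right hq).mpr (smul_right_injective A (inv_ne_zero hc.ne') absorb)

end StarProjection

theorem exists_cfc_le_smul_cfc {g h : ℝ → ℝ} {A : Matrix n n ℂ}
    (hh : ∀ x ∈ spectrum ℝ A, 0 ≤ h x) (hgh : ∀ x ∈ spectrum ℝ A, h x = 0 → g x ≤ 0) :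
    ∃ c : ℝ, 1 ≤ c ∧ cfc g A ≤ c • cfc h A := by
  have hcont (f : ℝ → ℝ) : ContinuousOn f (spectrum ℝ A) := A.finite_real_spectrum.continuousOn f
  obtain ⟨c, hc⟩ := (A.finite_real_spectrum.image fun x ↦ g x / h x).bddAbove
  refine ⟨max c 1, le_max_right c 1, ?_⟩
  rw [← cfc_smul (max c 1) h A (hcont _)]
  refine cfc_mono (fun x hx ↦ ?_) (hcont _) (hcont _)
  rcases (hh x hx).eq_or_lt' with hx0 | hx0
  · simpa [hx0] using hgh x hx hx0
  · exact (div_le_iff₀ hx0).mp ((hc (mem_image_of_mem _ hx)).trans (le_max_left c 1))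

theorem exists_le_smul_supp {A : Matrix n n ℂ} (hA : A.IsHermitian) :
    ∃ c : ℝ, 1 ≤ c ∧ A ≤ c • supp A := by
  simpa only [supp, cfc_id ℝ A hA.isSelfAdjoint] using
    exists_cfc_le_smul_cfc (g := id) (h := fun x ↦ if x = 0 then 0 else 1) (A := A)
      (fun x _ ↦ by split_ifs <;> simp) (fun x _ ↦ by simp +contextual)

theorem exists_supp_le_smul {A : Matrix n n ℂ} (hA : 0 ≤ A) :
    ∃ c : ℝ, 1 ≤ c ∧ supp A ≤ c • A := by
  simpa only [supp, cfc_id ℝ A (IsSelfAdjoint.of_nonneg hA)] using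
    exists_cfc_le_smul_cfc (g := fun x ↦ if x = 0 then 0 else 1) (h := id) (A := A)
      (fun x hx ↦ spectrum_nonneg_of_nonneg hA hx) (fun x _ ↦ by simp +contextual)

theorem isStarProjection_supp (A : Matrix n n ℂ) : IsStarProjection (supp A) where
  isIdempotentElem := by
    rw [IsIdempotentElem, supp, ← cfc_mul _ _ A (A.finite_real_spectrum.continuousOn _)
      (A.finite_real_spectrum.continuousOn _)]
    exact cfc_congr fun x _ ↦ by simp
  isSelfAdjoint := cfc_predicate _ A

section Norm

open scoped Matrix.Norms.L2Operator

theorem supp_le_supp_iff {A B : Matrix n n ℂ} (hA : 0 ≤ A) (hB : 0 ≤ B) :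
    supp A ≤ supp B ↔ ∃ c : ℝ, 1 ≤ c ∧ A ≤ c • B := by
  obtain ⟨a, ha, le_suppA⟩ := exists_le_smul_supp (IsSelfAdjoint.of_nonneg hA).isHermitian
  obtain ⟨a', ha', suppA_le⟩ := exists_supp_le_smul hA
  obtain ⟨b, hb, le_suppB⟩ := exists_le_smul_supp (IsSelfAdjoint.of_nonneg hB).isHermitian
  obtain ⟨b', hb', suppB_le⟩ := exists_supp_le_smul hB
  constructor
  · intro h
    refine ⟨a * b', one_le_mul_of_one_le_of_one_le ha hb', ?_⟩
    rw [mul_smul]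
    exact le_suppA.trans (smul_le_smul_of_nonneg_left (h.trans suppB_le) (by positivity))
  · rintro ⟨c, hc, h⟩
    refine starProjection_le_of_le_smul (isStarProjection_supp A) (isStarProjection_supp B)
      (c := a' * (c * b)) (by positivity) ?_
    rw [mul_smul, mul_smul]
    refine suppA_le.trans (smul_le_smul_of_nonneg_left (h.trans ?_) (by positivity))
    exact smul_le_smul_of_nonneg_left le_suppB (by positivity)

end Norm

theorem supp_map_le (T : Matrix n n ℂ →ₚ[ℂ] Matrix p p ℂ) {A B : Matrix n n ℂ} (hA : 0 ≤ A)
    (hB : 0 ≤ B) (h : supp A ≤ supp B) : supp (T A) ≤ supp (T B) := by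
  obtain ⟨c, hc, hAB⟩ := (supp_le_supp_iff hA hB).mp h
  refine (supp_le_supp_iff (map_nonneg T hA) (map_nonneg T hB)).mpr ⟨c, hc, ?_⟩
  rw [← PositiveLinearMap.map_smul_of_tower]
  exact OrderHomClass.mono T hAB

theorem SupportCondition.map {f : ℝ → ℝ} (T : Matrix n n ℂ →ₚ[ℂ] Matrix p p ℂ)
    {A B : Matrix n n ℂ} (hA : 0 ≤ A) (hB : 0 ≤ B) (h : SupportCondition f A B) :
    SupportCondition f (T A) (T B) := by
  rcases h with heq | hfin | ⟨hf, hle⟩ | ⟨hf, hge⟩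
  · exact .inl ((supp_map_le T hA hB heq.le).antisymm (supp_map_le T hB hA heq.ge))
  · exact .inr (.inl hfin)
  · exact .inr (.inr (.inl ⟨hf, supp_map_le T hA hB hle⟩))
  · exact .inr (.inr (.inr ⟨hf, supp_map_le T hB hA hge⟩))

end Support

section Existence

open Set

variable {n : Type*} [Fintype n] [DecidableEq n] {A B : Matrix n n ℂ} {c : ℝ}

theorem spectrum_relOp_subset_Ioi (hA : A.PosDef) (hB : B.PosDef) :
    spectrum ℝ (relOp A B) ⊆ Ioi 0 :=
  fun _ hx ↦ (posDef_relOp hA hB).isStrictlyPositive.spectrum_pos hx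

theorem relOp_smul_self (hB : B.PosDef) (c : ℝ) : relOp (c • B) B = algebraMap ℝ _ c := by
  rw [Algebra.algebraMap_eq_smul_one, ← relOp_self hB]
  simp only [relOp, Matrix.mul_smul, Matrix.smul_mul]

theorem spectrum_relOp_subset_Iic (hA : A.IsHermitian) (hB : B.PosDef) (h : A ≤ c • B) :
    spectrum ℝ (relOp A B) ⊆ Iic c := by
  have hle := relOp_mono h B
  rwa [relOp_smul_self hB,
    le_algebraMap_iff_spectrum_le (isHermitian_relOp hA B).isSelfAdjoint] at hle

theorem spectrum_relOp_subset_Ici (hA : A.IsHermitian) (hB : B.PosDef) (h : c • B ≤ A) :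
    spectrum ℝ (relOp A B) ⊆ Ici c := by
  have hle := relOp_mono h B
  rwa [relOp_smul_self hB,
    algebraMap_le_iff_le_spectrum (isHermitian_relOp hA B).isSelfAdjoint] at hle

theorem add_smul_one_le_smul {n : Type*} [Finite n] [DecidableEq n] {A B : Matrix n n ℂ}
    (hc : 1 ≤ c) (h : A ≤ c • B) {ε : ℝ} (hε : 0 ≤ ε) :
    A + ε • 1 ≤ c • (B + ε • 1) := by
  cases nonempty_fintype n
  rw [smul_add, smul_smul]
  exact add_le_add h (smul_le_smul_of_nonneg_right (le_mul_of_one_le_left hε hc) zero_le_one)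

theorem opPerspPos_le_smul_add {f : ℝ → ℝ} {K : ℝ} (hA : A.IsHermitian) (hB : B.PosDef)
    (hf : ∀ x ∈ spectrum ℝ (relOp A B), f x ≤ K * (1 + x)) :
    opPerspPos f A B ≤ K • (A + B) := by
  obtain ⟨G, l, hG, hl, hsum⟩ := exists_opPerspPos_eq_sum_smul hA B
  have sum_one : ∑ i, G i = B := by
    simpa [opPerspPos_const_one hA hB.posSemidef.nonneg] using (hsum fun _ ↦ 1).symm
  have sum_id : ∑ i, l i • G i = A := by simpa [opPerspPos_id hA hB] using (hsum id).symm
  calc opPerspPos f A B = ∑ i, f (l i) • G i := hsum f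
    _ ≤ ∑ i, (K * (1 + l i)) • G i :=
      Finset.sum_le_sum fun i _ ↦ smul_le_smul_of_nonneg_right (hf _ (hl i)) (hG i)
    _ = K • (A + B) := by
      simp only [mul_smul, add_smul, one_smul, ← Finset.smul_sum, Finset.sum_add_distrib, sum_one,
        sum_id, add_comm]

theorem OperatorConvex.opPerspDefined_of_spectrum_subset {f : ℝ → ℝ} (hf : OperatorConvex f)
    (hA : 0 ≤ A) (hB : 0 ≤ B) {s : Set ℝ} (hs : LinearlyBoundedAboveOn f s)
    (hsub : ∀ ε > (0 : ℝ), spectrum ℝ (relOp (A + ε • 1) (B + ε • 1)) ⊆ s) :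
    OpPerspDefined f A B := by
  obtain ⟨K, hK⟩ := hs
  have regPersp_le {ε : ℝ} (hε : 0 < ε) (hε₁ : ε ≤ 1) :
      regPersp f A B ε ≤ K • (A + B) + |2 * K - f 1| • 1 := by
    have hAε := posDef_add_smul_one hA hε
    have hBε := posDef_add_smul_one hB hε
    have hle := opPerspPos_le_smul_add (f := f) hAε.isHermitian hBε fun x hx ↦
      (div_le_iff₀ (add_pos one_pos (spectrum_relOp_subset_Ioi hAε hBε hx))).mp
        (hK (mem_image_of_mem _ (hsub ε hε hx)))
    calc regPersp f A B ε ≤ K • (A + ε • 1 + (B + ε • 1)) - (ε * f 1) • 1 :=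
          sub_le_sub_right hle _
      _ = K • (A + B) + (ε * (2 * K - f 1)) • 1 := by module
      _ ≤ K • (A + B) + |2 * K - f 1| • 1 := by
        refine add_le_add_right (smul_le_smul_of_nonneg_right ?_ zero_le_one) _
        exact (mul_le_mul_of_nonneg_left (le_abs_self _) hε.le).trans
          (mul_le_of_le_one_left (abs_nonneg _) hε₁)
  refine hf.opPerspDefined_of_bddAbove hA hB
    ⟨K • (A + B) + |2 * K - f 1| • 1, forall_mem_image.mpr fun ε (hε : 0 < ε) ↦ ?_⟩
  have hmin : 0 < min ε 1 := lt_min hε one_pos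
  exact (hf.regPersp_antitoneOn hA hB hmin hε (min_le_left ε 1)).trans
    (regPersp_le hmin (min_le_right ε 1))

theorem OperatorConvex.opPerspDefined_of_supportCondition {f : ℝ → ℝ} (hf : OperatorConvex f)
    (hA : 0 ≤ A) (hB : 0 ≤ B) (h : SupportCondition f A B) : OpPerspDefined f A B := by
  have hAε {ε : ℝ} (hε : 0 < ε) := posDef_add_smul_one hA hε
  have hBε {ε : ℝ} (hε : 0 < ε) := posDef_add_smul_one hB hε
  have spectrum_pos (ε : ℝ) (hε : 0 < ε) :
      spectrum ℝ (relOp (A + ε • 1) (B + ε • 1)) ⊆ Ioi 0 :=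
    spectrum_relOp_subset_Ioi (hAε hε) (hBε hε)
  have spectrum_le (hle : supp A ≤ supp B) : ∃ c, ∀ ε > (0 : ℝ),
      spectrum ℝ (relOp (A + ε • 1) (B + ε • 1)) ⊆ Iic c := by
    obtain ⟨c, hc, hAB⟩ := (supp_le_supp_iff hA hB).mp hle
    exact ⟨c, fun ε hε ↦ spectrum_relOp_subset_Iic (hAε hε).isHermitian (hBε hε)
      (add_smul_one_le_smul hc hAB hε.le)⟩
  have spectrum_ge (hge : supp B ≤ supp A) : ∃ c > 0, ∀ ε > (0 : ℝ),
      spectrum ℝ (relOp (A + ε • 1) (B + ε • 1)) ⊆ Ici c := by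
    obtain ⟨c, hc, hBA⟩ := (supp_le_supp_iff hB hA).mp hge
    have hc0 : 0 < c := one_pos.trans_le hc
    exact ⟨c⁻¹, inv_pos.mpr hc0, fun ε hε ↦ spectrum_relOp_subset_Ici (hAε hε).isHermitian (hBε hε)
      ((inv_smul_le_iff_of_pos hc0).mpr (add_smul_one_le_smul hc hBA hε.le))⟩
  rcases h with heq | ⟨hf0, hf'⟩ | ⟨hf0, hle⟩ | ⟨hf', hge⟩
  · obtain ⟨c, hc, hsub⟩ := spectrum_ge heq.ge
    obtain ⟨d, hsub'⟩ := spectrum_le heq.le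
    exact hf.opPerspDefined_of_spectrum_subset hA hB
      (linearlyBoundedAboveOn_Icc hf.continuousOn hc d) fun ε hε _ hx ↦
        ⟨hsub ε hε hx, hsub' ε hε hx⟩
  · exact hf.opPerspDefined_of_spectrum_subset hA hB
      (hf0.linearlyBoundedAboveOn_Ioi hf' hf.continuousOn) spectrum_pos
  · obtain ⟨d, hsub⟩ := spectrum_le hle
    exact hf.opPerspDefined_of_spectrum_subset hA hB
      (hf0.linearlyBoundedAboveOn_Ioc hf.continuousOn d) fun ε hε _ hx ↦
        ⟨spectrum_pos ε hε hx, hsub ε hε hx⟩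
  · obtain ⟨c, hc, hsub⟩ := spectrum_ge hge
    exact hf.opPerspDefined_of_spectrum_subset hA hB
      (hf'.linearlyBoundedAboveOn_Ici hf.continuousOn hc) hsub

end Existence

section IdTensor

variable {m n k l : Type*} [Fintype m] [DecidableEq m]

theorem idTensor_comp (F : SuperOp k l) (N : SuperOp n k) :
    idTensor m (F ∘ₗ N) = idTensor m F ∘ₗ idTensor m N :=
  LinearMap.ext fun X ↦ ext_block fun a b ↦ by
    simp only [LinearMap.comp_apply, blockAt_idTensor]

theorem idTensor_sum {ι : Type*} [Fintype ι] (N : ι → SuperOp n k) :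
    idTensor m (∑ i, N i) = ∑ i, idTensor m (N i) :=
  LinearMap.ext fun X ↦ ext_block fun a b ↦ by
    simp only [LinearMap.sum_apply, map_sum, blockAt_idTensor]

/-- The identification of `m × m` matrices over `B(ℂ^n)` with `B(ℂ^m ⊗ ℂ^n)`, under which entrywise
application of `N` becomes `id ⊗ N`. -/
def flatten (m n : Type*) [Fintype m] [Fintype n] :
    CStarMatrix m m (Matrix n n ℂ) ≃⋆+* Matrix (m × n) (m × n) ℂ where
  toEquiv := Matrix.comp m m n n ℂ
  map_add' _ _ := rfl
  map_mul' X Y := map_mul (Matrix.compRingEquiv m n ℂ) X Y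
  map_star' X := by
    ext p q
    exact rfl

theorem flatten_map [Fintype n] [Fintype k] (N : SuperOp n k) (X : CStarMatrix m m (Matrix n n ℂ)) :
    flatten m k (X.map N) = idTensor m N (flatten m n X) :=
  ext_block fun a b ↦ (blockAt_idTensor N (flatten m n X) a b).symm

end IdTensor

section Kraus

open scoped Kronecker

variable {m n k : Type*} [Fintype m] [DecidableEq m] [Fintype n]

theorem blockAt_apply {m n : Type*} (a b : m) (X : Matrix (m × n) (m × n) ℂ) (i j : n) :
    blockAt a b X i j = X (a, i) (b, j) :=
  rfl

theorem embedAt_apply {m n : Type*} [DecidableEq m] (a b : m) (x : Matrix n n ℂ) (p q : m × n) :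
    embedAt a b x p q = Matrix.single a b 1 p.1 q.1 * x p.2 q.2 :=
  rfl

/-- The superoperator `ρ ↦ K ρ K†` with the single Kraus operator `K`. -/
def conjMap (K : Matrix k n ℂ) : SuperOp n k where
  toFun ρ := K * ρ * Kᴴ
  map_add' ρ σ := by rw [Matrix.mul_add, Matrix.add_mul]
  map_smul' c ρ := by rw [Matrix.mul_smul, Matrix.smul_mul, RingHom.id_apply]

theorem conjMap_apply (K : Matrix k n ℂ) (ρ : Matrix n n ℂ) : conjMap K ρ = K * ρ * Kᴴ :=
  rfl

theorem idTensor_conjMap (K : Matrix k n ℂ) :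
    idTensor m (conjMap K) = conjMap ((1 : Matrix m m ℂ) ⊗ₖ K) := by
  refine LinearMap.ext fun X ↦ ext_block fun a b ↦ ?_
  rw [blockAt_idTensor]
  ext i j
  simp [conjMap_apply, blockAt_apply, Matrix.mul_apply, Fintype.sum_prod_type, Matrix.one_apply,
    Finset.sum_mul, apply_ite]

theorem blockAt_self_eq_conjMap [DecidableEq n] (a : m) :
    blockAt (n := n) a a = conjMap ((1 : Matrix (m × n) (m × n) ℂ).submatrix (Prod.mk a) id) := by
  ext X i j
  simp [conjMap_apply, blockAt_apply, Matrix.mul_apply, Matrix.one_apply]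

theorem embedAt_self_eq_conjMap {m n : Type*} [DecidableEq m] [Fintype n] [DecidableEq n] (a : m) :
    embedAt (n := n) a a = conjMap ((1 : Matrix (m × n) (m × n) ℂ).submatrix id (Prod.mk a)) := by
  refine LinearMap.ext fun x ↦ ?_
  ext ⟨b, i⟩ ⟨c, j⟩
  by_cases hb : b = a <;> by_cases hc : c = a <;>
    simp [*, eq_comm (a := a), conjMap_apply, embedAt_apply, Matrix.mul_apply, Matrix.one_apply]

theorem choi_conjMap (Ψ : ChoiVector m n) (K : Matrix k n ℂ) :
    choi Ψ (conjMap K) = Matrix.vecMulVec (((1 : Matrix m m ℂ) ⊗ₖ K) *ᵥ Ψ.vec)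
      (star (((1 : Matrix m m ℂ) ⊗ₖ K) *ᵥ Ψ.vec)) := by
  change idTensor m (conjMap K) Ψ.proj = _
  rw [idTensor_conjMap, conjMap_apply, ChoiVector.proj, Matrix.mul_vecMulVec,
    Matrix.vecMulVec_mul, Matrix.star_mulVec]

theorem ChoiVector.exists_one_kronecker_mulVec_eq (Ψ : ChoiVector m n) (w : m × k → ℂ) :
    ∃ K : Matrix k n ℂ, ((1 : Matrix m m ℂ) ⊗ₖ K) *ᵥ Ψ.vec = w := by
  classical
  let U : Matrix m n ℂ := Matrix.of fun a i ↦ Ψ.vec (a, i)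
  let W : Matrix m k ℂ := Matrix.of fun a i ↦ w (a, i)
  refine ⟨Wᵀ * Uᴴᵀ, ?_⟩
  change _ *ᵥ Uᵀ.vec = Wᵀ.vec
  rw [Matrix.kronecker_mulVec_vec, Matrix.mul_assoc Wᵀ, ← Matrix.transpose_mul, Ψ.unitary.2,
    Matrix.transpose_one, Matrix.mul_one, Matrix.mul_one]

end Kraus

section CompletePositivity

open scoped Matrix.Norms.L2Operator

variable {m n k l : Type*} [Fintype m] [DecidableEq m] [Fintype n] [DecidableEq n] [Fintype k]
  [DecidableEq k] [Fintype l] [DecidableEq l]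

theorem flatten_nonneg_iff {m : Type*} [Fintype m] {X : CStarMatrix m m (Matrix n n ℂ)} :
    0 ≤ flatten m n X ↔ 0 ≤ X := by
  classical
  rw [← map_zero (flatten m n), map_le_map_iff]

theorem IsCP.idTensor_nonneg {N : SuperOp n k} (hN : IsCP N) {X : Matrix (m × n) (m × n) ℂ}
    (hX : 0 ≤ X) : 0 ≤ idTensor m N X := by
  obtain ⟨φ, rfl⟩ := hN
  obtain ⟨X, rfl⟩ := EquivLike.surjective (flatten m n) X
  rw [← flatten_map]
  exact flatten_nonneg_iff.mpr (φ.map_cstarMatrix_nonneg X (flatten_nonneg_iff.mp hX))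

theorem isCP_iff_idTensor_nonneg {N : SuperOp n k} :
    IsCP N ↔
      ∀ (r : ℕ) (X : Matrix (Fin r × n) (Fin r × n) ℂ), 0 ≤ X → 0 ≤ idTensor (Fin r) N X := by
  refine ⟨fun hN r X ↦ hN.idTensor_nonneg, fun h ↦ ⟨⟨N, fun r X hX ↦ ?_⟩, rfl⟩⟩
  rw [← flatten_nonneg_iff, flatten_map]
  exact h r _ (flatten_nonneg_iff.mpr hX)

theorem IsCP.comp {F : SuperOp k l} {N : SuperOp n k} (hF : IsCP F) (hN : IsCP N) :
    IsCP (F ∘ₗ N) :=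
  isCP_iff_idTensor_nonneg.mpr fun r X hX ↦ by
    rw [idTensor_comp]
    exact hF.idTensor_nonneg (hN.idTensor_nonneg hX)

theorem IsCP.sum {ι : Type*} [Fintype ι] {N : ι → SuperOp n k} (hN : ∀ i, IsCP (N i)) :
    IsCP (∑ i, N i) :=
  isCP_iff_idTensor_nonneg.mpr fun r X hX ↦ by
    rw [idTensor_sum, LinearMap.sum_apply]
    exact Finset.sum_nonneg fun i _ ↦ (hN i).idTensor_nonneg hX

theorem isCP_conjMap (K : Matrix k n ℂ) : IsCP (conjMap K) :=
  isCP_iff_idTensor_nonneg.mpr fun r X hX ↦ by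
    rw [idTensor_conjMap]
    exact ((Matrix.nonneg_iff_posSemidef.mp hX).mul_mul_conjTranspose_same _).nonneg

theorem isCP_blockAt (a : m) : IsCP (blockAt (n := n) a a) := by
  rw [blockAt_self_eq_conjMap]
  exact isCP_conjMap _

theorem isCP_embedAt (a : m) : IsCP (embedAt (n := n) a a) := by
  rw [embedAt_self_eq_conjMap]
  exact isCP_conjMap _

theorem isCP_iff_choi_nonneg (Ψ : ChoiVector m n) {N : SuperOp n k} :
    IsCP N ↔ 0 ≤ choi Ψ N := by
  refine ⟨fun hN ↦ hN.idTensor_nonneg (Matrix.posSemidef_vecMulVec_self_star Ψ.vec).nonneg,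
    fun h ↦ ?_⟩
  obtain ⟨r, w, hw⟩ := Matrix.posSemidef_iff_eq_sum_vecMulVec.mp (Matrix.nonneg_iff_posSemidef.mp h)
  choose K hK using fun i ↦ Ψ.exists_one_kronecker_mulVec_eq (w i)
  have kraus : N = ∑ i, conjMap (K i) := (choi Ψ).injective <| by
    simp only [hw, map_sum, choi_conjMap, hK]
  rw [kraus]
  exact IsCP.sum fun i ↦ isCP_conjMap (K i)

end CompletePositivity

section Superoperators

open scoped Matrix.Norms.L2Operator

variable {m m' n k n₂ k₂ : Type*} [Fintype m] [DecidableEq m] [Fintype m'] [DecidableEq m']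
  [Fintype n] [DecidableEq n] [Fintype k] [DecidableEq k] [Fintype n₂] [DecidableEq n₂]
  [Fintype k₂] [DecidableEq k₂] {f : ℝ → ℝ} {N M : SuperOp n k} {Θ : Supermap n k n₂ k₂}

/-- The positive linear map that `Θ` induces on Choi matrices, when `Θ` preserves complete
positivity. -/
noncomputable def Supermap.PreservesCP.choiMap (hΘ : Θ.PreservesCP) (Ψ : ChoiVector m n)
    (Φ : ChoiVector m' n₂) : Matrix (m × k) (m × k) ℂ →ₚ[ℂ] Matrix (m' × k₂) (m' × k₂) ℂ :=
  .mk₀ ((choi Φ).toLinearMap ∘ₗ Θ ∘ₗ (choi Ψ).symm.toLinearMap) fun Z hZ ↦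
    (isCP_iff_choi_nonneg Φ).mp <| hΘ _ <| (isCP_iff_choi_nonneg Ψ).mpr <| by
      rwa [LinearEquiv.coe_coe, LinearEquiv.apply_symm_apply]

theorem Supermap.PreservesCP.choiMap_apply (hΘ : Θ.PreservesCP) (Ψ : ChoiVector m n)
    (Φ : ChoiVector m' n₂) (Z : Matrix (m × k) (m × k) ℂ) :
    hΘ.choiMap Ψ Φ Z = choi Φ (Θ ((choi Ψ).symm Z)) :=
  rfl

theorem Supermap.PreservesCP.choiMap_choi (hΘ : Θ.PreservesCP) (Ψ : ChoiVector m n)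
    (Φ : ChoiVector m' n₂) (N : SuperOp n k) : hΘ.choiMap Ψ Φ (choi Ψ N) = choi Φ (Θ N) := by
  rw [choiMap_apply, LinearEquiv.symm_apply_apply]

theorem Supermap.PreservesCP.supportCondition (hΘ : Θ.PreservesCP) (hN : IsCP N) (hM : IsCP M)
    {Ψ : ChoiVector m n} (h : SupportCondition f (choi Ψ N) (choi Ψ M)) (Φ : ChoiVector m' n₂) :
    SupportCondition f (choi Φ (Θ N)) (choi Φ (Θ M)) := by
  simpa only [hΘ.choiMap_choi] using h.map (hΘ.choiMap Ψ Φ) ((isCP_iff_choi_nonneg Ψ).mp hN)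
    ((isCP_iff_choi_nonneg Ψ).mp hM)

theorem LECP.map (hΘ : Θ.PreservesCP) (h : LECP N M) : LECP (Θ N) (Θ M) := by
  simpa only [LECP, map_sub] using hΘ _ h

theorem lecp_iff_choi_le (Φ : ChoiVector m n) : LECP N M ↔ choi Φ N ≤ choi Φ M := by
  rw [LECP, isCP_iff_choi_nonneg Φ, map_sub, sub_nonneg]

theorem LECP.antisymm {m : Type*} [Fintype m] (Φ : ChoiVector m n) (h₁ : LECP N M)
    (h₂ : LECP M N) : N = M := by
  classical
  exact (choi Φ).injective (((lecp_iff_choi_le Φ).mp h₁).antisymm ((lecp_iff_choi_le Φ).mp h₂))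

theorem OperatorConvex.superPerspDefined_of_supportCondition (hf : OperatorConvex f)
    (hN : IsCP N) (hM : IsCP M) {Ψ : ChoiVector m n}
    (h : SupportCondition f (choi Ψ N) (choi Ψ M)) : SuperPerspDefined Ψ f N M :=
  hf.opPerspDefined_of_supportCondition ((isCP_iff_choi_nonneg Ψ).mp hN)
    ((isCP_iff_choi_nonneg Ψ).mp hM) h

theorem OperatorConvex.superPerspDefined_map (hf : OperatorConvex f) (hN : IsCP N) (hM : IsCP M)
    {Ψ : ChoiVector m n} (h : SuperPerspDefined Ψ f N M) (hΘ : Θ.PreservesCP)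
    (Φ : ChoiVector m' n₂) : SuperPerspDefined Φ f (Θ N) (Θ M) := by
  simpa only [SuperPerspDefined, hΘ.choiMap_choi] using hf.opPerspDefined_map (hΘ.choiMap Ψ Φ)
    ((isCP_iff_choi_nonneg Ψ).mp hN) ((isCP_iff_choi_nonneg Ψ).mp hM) h

theorem OperatorConvex.superPersp_map_le (hf : OperatorConvex f) (hN : IsCP N) (hM : IsCP M)
    {Ψ : ChoiVector m n} (h : SuperPerspDefined Ψ f N M) (hΘ : Θ.PreservesCP)
    (Φ : ChoiVector m' n₂) :
    LECP (superPersp Φ f (Θ N) (Θ M)) (Θ (superPersp Ψ f N M)) := by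
  rw [lecp_iff_choi_le Φ, superPersp, superPersp, LinearEquiv.apply_symm_apply]
  simpa only [hΘ.choiMap_choi, hΘ.choiMap_apply] using hf.opPersp_map_le (hΘ.choiMap Ψ Φ)
    ((isCP_iff_choi_nonneg Ψ).mp hN) ((isCP_iff_choi_nonneg Ψ).mp hM) h

theorem OperatorConvex.superPersp_map_eq (hf : OperatorConvex f) (hN : IsCP N) (hM : IsCP M)
    {Ψ : ChoiVector m n} (h : SuperPerspDefined Ψ f N M) (hΘ : Θ.PreservesCP)
    {Ξ : Supermap n₂ k₂ n k} (hΞ : Ξ.PreservesCP) (hΞΘ : ∀ Λ, Ξ (Θ Λ) = Λ)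
    (hΘΞ : ∀ Λ, Θ (Ξ Λ) = Λ) (Φ : ChoiVector m' n₂) :
    superPersp Φ f (Θ N) (Θ M) = Θ (superPersp Ψ f N M) := by
  refine (hf.superPersp_map_le hN hM h hΘ Φ).antisymm Φ ?_
  have hle := hf.superPersp_map_le (hΘ N hN) (hΘ M hM) (hf.superPerspDefined_map hN hM h hΘ Φ) hΞ Ψ
  rw [hΞΘ, hΞΘ] at hle
  simpa only [hΘΞ] using hle.map hΘ

theorem Supermap.preservesCP_id : Supermap.PreservesCP (.id : Supermap n k n k) :=
  fun _ hΛ ↦ hΛ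

theorem OperatorConvex.superPersp_eq_superPersp (hf : OperatorConvex f) (hN : IsCP N)
    (hM : IsCP M) {Ψ : ChoiVector m n} (h : SuperPerspDefined Ψ f N M) (Φ : ChoiVector m' n) :
    superPersp Φ f N M = superPersp Ψ f N M :=
  hf.superPersp_map_eq hN hM h Supermap.preservesCP_id Supermap.preservesCP_id (fun _ ↦ rfl)
    (fun _ ↦ rfl) Φ

/-- Post-processing `N ↦ F ∘ N`, as a supermap. -/
abbrev Supermap.postcomp {l : Type*} (F : SuperOp k l) : Supermap n k n l :=
  LinearMap.compRight ℂ F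

/-- Pre-processing `N ↦ N ∘ E`, as a supermap. -/
abbrev Supermap.precomp {l : Type*} (E : SuperOp l n) : Supermap n k l k :=
  LinearMap.lcomp ℂ (Matrix k k ℂ) E

theorem IsCP.preservesCP_postcomp {l : Type*} [Fintype l] [DecidableEq l] {F : SuperOp k l}
    (hF : IsCP F) : (Supermap.postcomp F : Supermap n k n l).PreservesCP :=
  fun _ hΛ ↦ hF.comp hΛ

theorem IsCP.preservesCP_precomp {l : Type*} [Fintype l] [DecidableEq l] {E : SuperOp l n}
    (hE : IsCP E) : (Supermap.precomp E : Supermap n k l k).PreservesCP :=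
  fun _ hΛ ↦ hΛ.comp hE

theorem OperatorConvex.superPersp_comp_eq {l : Type*} [Fintype l] [DecidableEq l]
    (hf : OperatorConvex f) (hN : IsCP N) (hM : IsCP M) {Ψ : ChoiVector m n}
    (h : SuperPerspDefined Ψ f N M) {F : SuperOp k l} {G : SuperOp l k} (hF : IsCP F)
    (hG : IsCP G) (hGF : G ∘ₗ F = .id) (hFG : F ∘ₗ G = .id) (Φ : ChoiVector m' n) :
    superPersp Φ f (F ∘ₗ N) (F ∘ₗ M) = F ∘ₗ superPersp Ψ f N M :=
  hf.superPersp_map_eq hN hM h hF.preservesCP_postcomp hG.preservesCP_postcomp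
    (fun Λ ↦ congrArg (· ∘ₗ Λ) hGF) (fun Λ ↦ congrArg (· ∘ₗ Λ) hFG) Φ

theorem Supermap.IsCPSupermap.preservesCP (hΘ : Θ.IsCPSupermap) : Θ.PreservesCP := by
  intro Λ hΛ
  let Λ₁ : SuperOp (Fin 1 × n) (Fin 1 × k) := embedAt 0 0 ∘ₗ Λ ∘ₗ blockAt 0 0
  have compress : blockAt 0 0 ∘ₗ Λ₁ ∘ₗ embedAt 0 0 = Λ :=
    LinearMap.ext fun x ↦ by simp [Λ₁, blockAt_embedAt]
  have compress_map : blockAt 0 0 ∘ₗ Θ.idTensor Λ₁ ∘ₗ embedAt 0 0 = Θ Λ :=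
    LinearMap.ext fun x ↦ by simp [Supermap.idTensor, compress, blockAt_embedAt]
  have hΛ₁ : IsCP Λ₁ := (isCP_embedAt 0).comp (hΛ.comp (isCP_blockAt 0))
  rw [← compress_map]
  exact (isCP_blockAt 0).comp ((hΘ 1 1 Λ₁ hΛ₁).comp (isCP_embedAt 0))

end Superoperators

end SuperPersp

theorem mainTheorem12
    {h k : Type*} [Fintype h] [DecidableEq h] [Fintype k] [DecidableEq k]
    (f : ℝ → ℝ) (hf : OperatorConvex f)
    (N M : SuperOp h k) (hN : IsCP N) (hM : IsCP M)
    {h' : Type*} [Fintype h'] [DecidableEq h'] (Ψ : ChoiVector h' h)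
    (hS : SupportCondition f (choi Ψ N) (choi Ψ M)) :
    -- `P_f(N, M)` is defined, and nothing depends on the choice of the Choi vector
    (∀ {m : Type*} [Fintype m] [DecidableEq m] (Φ : ChoiVector m h),
      SupportCondition f (choi Φ N) (choi Φ M) ∧
      SuperPerspDefined Φ f N M ∧
      superPersp Φ f N M = superPersp Ψ f N M) ∧
    -- post-processing
    (∀ {l : Type*} [Fintype l] [DecidableEq l] (F : SuperOp k l), IsCP F →
      ∀ {m : Type*} [Fintype m] [DecidableEq m] (Φ : ChoiVector m h),
        SuperPerspDefined Φ f (F ∘ₗ N) (F ∘ₗ M) ∧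
        LECP (superPersp Φ f (F ∘ₗ N) (F ∘ₗ M)) (F ∘ₗ superPersp Ψ f N M) ∧
        ((∃ G : SuperOp l k, IsCP G ∧ G ∘ₗ F = LinearMap.id ∧ F ∘ₗ G = LinearMap.id) →
          superPersp Φ f (F ∘ₗ N) (F ∘ₗ M) = F ∘ₗ superPersp Ψ f N M)) ∧
    -- pre-processing
    (∀ {l : Type*} [Fintype l] [DecidableEq l] (E : SuperOp l h), IsCP E →
      ∀ {m : Type*} [Fintype m] [DecidableEq m] (Φ : ChoiVector m l),
        SuperPerspDefined Φ f (N ∘ₗ E) (M ∘ₗ E) ∧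
        LECP (superPersp Φ f (N ∘ₗ E) (M ∘ₗ E)) (superPersp Ψ f N M ∘ₗ E)) ∧
    -- completely positive supermaps
    (∀ {h₂ k₂ : Type*} [Fintype h₂] [DecidableEq h₂] [Fintype k₂] [DecidableEq k₂]
      (Θ : Supermap h k h₂ k₂), Θ.IsCPSupermap →
      ∀ {m : Type*} [Fintype m] [DecidableEq m] (Φ : ChoiVector m h₂),
        SuperPerspDefined Φ f (Θ N) (Θ M) ∧
        LECP (superPersp Φ f (Θ N) (Θ M)) (Θ (superPersp Ψ f N M))) ∧
    -- more generally, supermaps that preserve complete positivity of superoperators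
    (∀ {h₂ k₂ : Type*} [Fintype h₂] [DecidableEq h₂] [Fintype k₂] [DecidableEq k₂]
      (Θ : Supermap h k h₂ k₂), Θ.PreservesCP →
      ∀ {m : Type*} [Fintype m] [DecidableEq m] (Φ : ChoiVector m h₂),
        SuperPerspDefined Φ f (Θ N) (Θ M) ∧
        LECP (superPersp Φ f (Θ N) (Θ M)) (Θ (superPersp Ψ f N M))) := by
  have hd : SuperPerspDefined Ψ f N M := hf.superPerspDefined_of_supportCondition hN hM hS
  refine ⟨fun Φ ↦ ⟨?_, ?_, ?_⟩, fun F hF _ _ _ Φ ↦ ⟨?_, ?_, ?_⟩, fun E hE _ _ _ Φ ↦ ?_,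
    fun Θ hΘ _ _ _ Φ ↦ ?_, fun Θ hΘ _ _ _ Φ ↦ ?_⟩
  · exact Supermap.preservesCP_id.supportCondition hN hM hS Φ
  · exact hf.superPerspDefined_map hN hM hd Supermap.preservesCP_id Φ
  · exact hf.superPersp_eq_superPersp hN hM hd Φ
  · exact hf.superPerspDefined_map hN hM hd hF.preservesCP_postcomp Φ
  · exact hf.superPersp_map_le hN hM hd hF.preservesCP_postcomp Φ
  · exact fun ⟨G, hG, hGF, hFG⟩ ↦ hf.superPersp_comp_eq hN hM hd hF hG hGF hFG Φ
  · exact ⟨hf.superPerspDefined_map hN hM hd hE.preservesCP_precomp Φ,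
      hf.superPersp_map_le hN hM hd hE.preservesCP_precomp Φ⟩
  · exact ⟨hf.superPerspDefined_map hN hM hd hΘ.preservesCP Φ,
      hf.superPersp_map_le hN hM hd hΘ.preservesCP Φ⟩
  · exact ⟨hf.superPerspDefined_map hN hM hd hΘ Φ, hf.superPersp_map_le hN hM hd hΘ Φ⟩
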